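/- \textbf{Setting.} Let $y_1,y_2,\dots$ be random data on a probability space, and write $y_{1:n}=(y_1,\dots,y_n)$. Let $\Theta\subseteq\mathbb R^d$ be measurable, let $E\subseteq\Theta$ be open and bounded in $\mathbb R^d$, and fix $\lambda_0\in E$. Let $\pi_0$ be a probability density on $\Theta$ that is continuous at $\lambda_0$ with $\pi_0(\lambda_0)>0$. For $n\ge 1$, let $L(y_{1:n},\zeta;\lambda)>0$ be an augmented likelihood ($\lambda\in\Theta$, $\zeta\in\mathbb R^p$, with $p$ fixed), let $g_n(\zeta,y_{1:n};\lambda)$ be a loss, and let $\hat z_n(\lambda)=\arg\min_{\zeta\in\mathbb R^p} g_n(\zeta,y_{1:n};\lambda)$ be its unique minimizer. Put $$l_n(\lambda,\zeta)=\tfrac1n\log L(y_{1:n},\zeta;\lambda),\qquad \hat l_n(\lambda)=l_n\{\lambda,\hat z_n(\lambda)\}.$$ Assume that $\lambda\mapsto L\{y_{1:n},\hat z_n(\lambda);\lambda\}$ is measurable. The bridged posterior $\Pi_n$ is the distribution on $\Theta$ whose Lebesgue density is proportional to $L\{y_{1:n},\hat z_n(\lambda);\lambda\}\,\pi_0(\lambda)$.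 \textbf{Assumptions.} There are deterministic functions $\hat z_*:\Theta\to\mathbb R^p$ and $l_*:\Theta\times\mathbb R^p\to\mathbb R$ and a compact $K\subseteq E$ with $\lambda_0$ in the interior of $K$ such that: (A1) Almost surely, there are $\delta>0$ and $M<\infty$ such that, for every $n\ge1$, $l_n$ has continuous third derivatives with $\|l_n'''\|\le M$ on $E\times\{\zeta:\operatorname{dist}(\zeta,\hat z_n(E))<\delta\}$, and $\hat z_n$ has continuous third derivatives with $\|\hat z_n'''\|\le M$ on $E$. (A2) Almost surely, $\hat z_n(\lambda)\to\hat z_*(\lambda)$ and $l_n(\lambda,\zeta)\to l_*(\lambda,\zeta)$ for all $\lambda\in\Theta$ and $\zeta\in\mathbb R^p$. (A3) The Hessian $l_*''$ in $(\lambda,\zeta)$ at $\{\lambda_0,\hat z_*(\lambda_0)\}$ is negative definite, and $\frac{\partial}{\partial\zeta}l_*(\lambda_0,\zeta)\big|_{\zeta=\hat z_*(\lambda_0)}=0$. (A4) $l_*(\lambda,\zeta)<l_*\{\lambda_0,\hat z_*(\lambda_0)\}$ for all $\lambda\in K\setminus\{\lambda_0\}$ and $\zeta\in\hat z_*(E)$,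 and, almost surely, $\limsup_{n}\sup_{\lambda\in\Theta\setminus K,\ \zeta\in\hat z_n(\Theta)}l_n(\lambda,\zeta)<l_*\{\lambda_0,\hat z_*(\lambda_0)\}$. \textbf{Theorem.} Let $\hat l_*(\lambda)=l_*\{\lambda,\hat z_*(\lambda)\}$. Then $\hat l_*$ is twice continuously differentiable near $\lambda_0$, the matrix $H_0=-\hat l_*''(\lambda_0)$ is positive definite, and there are (data-dependent) points $\lambda_n$ such that, almost surely: $\lambda_n\to\lambda_0$; $\hat l_n'(\lambda_n)=0$ for all $n$ large enough; $\hat l_n(\lambda_n)\to\hat l_*(\lambda_0)$; for all $n$ large enough $\Pi_n$ is a well-defined probability measure and $\sqrt n(\lambda-\lambda_n)$, with $\lambda\sim\Pi_n$, has a density $q_n$; and $$d_{TV}\bigl\{q_n,\ \mathcal N(0,H_0^{-1})\bigr\}\longrightarrow 0 \qquad (n\to\infty).$$ -/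

import Mathlib

open MeasureTheory Filter Topology

noncomputable section

namespace BridgedPosterior

/-- `z` is the unique minimizer of `f`. -/
def IsUniqueArgmin {X : Type*} (f : X → ℝ) (z : X) : Prop :=
  ∀ x, x ≠ z → f z < f x

/-- The sample `y_{1:n}` at the outcome `ω`. -/
def sample {Ω 𝒴 : Type*} (y : ℕ → Ω → 𝒴) (n : ℕ) (ω : Ω) : Fin n → 𝒴 :=
  fun i => y i ω

/-- `l_n(λ, ζ) = n⁻¹ log L(y_{1:n}, ζ; λ)`, as a function of the pair `(λ, ζ)`. -/
def logLik {𝒴 : Type*} {d p : ℕ}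
    (L : (n : ℕ) → (Fin n → 𝒴) → EuclideanSpace ℝ (Fin p) → EuclideanSpace ℝ (Fin d) → ℝ)
    (n : ℕ) (ys : Fin n → 𝒴) :
    EuclideanSpace ℝ (Fin d) × EuclideanSpace ℝ (Fin p) → ℝ :=
  fun x => Real.log (L n ys x.2 x.1) / n

/-- The profiled function `λ ↦ l (λ, z λ)`. -/
def profile {A B : Type*} (l : A × B → ℝ) (z : A → B) : A → ℝ :=
  fun lam => l (lam, z lam)

/-- The Hessian matrix of `f` at `x` in the standard coordinates. -/
def hessian {d : ℕ} (f : EuclideanSpace ℝ (Fin d) → ℝ) (x : EuclideanSpace ℝ (Fin d)) :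
    Matrix (Fin d) (Fin d) ℝ :=
  Matrix.of fun i j =>
    iteratedFDeriv ℝ 2 f x ![EuclideanSpace.single i 1, EuclideanSpace.single j 1]

/-- The posterior on the parameter space `Θ` with density proportional to `lik * prior` with
respect to Lebesgue measure. (It is the zero measure if the normalizing constant is `0` or `∞`.) -/
def posterior {d : ℕ} (Θ : Set (EuclideanSpace ℝ (Fin d)))
    (prior lik : EuclideanSpace ℝ (Fin d) → ℝ) : Measure (EuclideanSpace ℝ (Fin d)) :=
  (∫⁻ lam in Θ, ENNReal.ofReal (lik lam * prior lam))⁻¹ •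
    (volume.restrict Θ).withDensity fun lam => ENNReal.ofReal (lik lam * prior lam)

/-- The law of `√n (λ - c)` for `λ` distributed according to `μ`. -/
def rescaledLaw {d : ℕ} (μ : Measure (EuclideanSpace ℝ (Fin d))) (n : ℕ)
    (c : EuclideanSpace ℝ (Fin d)) : Measure (EuclideanSpace ℝ (Fin d)) :=
  μ.map fun lam => Real.sqrt n • (lam - c)

/-- The total variation distance `sup_A |μ(A) - ν(A)|` of two finite measures. -/
def tvDist {X : Type*} [MeasurableSpace X] (μ ν : Measure X) : ℝ :=
  ⨆ A : {A : Set X // MeasurableSet A}, |μ.real A - ν.real A|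

end BridgedPosterior

end

/-!
Asymptotic normality of the bridged posterior.

Fix an outcome of the data. Write `f n` for the profiled log-likelihood `λ ↦ l_n (λ, ẑ_n λ)` and
`g` for its limit `λ ↦ l_* (λ, z_* λ)`; for `n ≥ 1` the bridged posterior has density proportional
to `exp (n f n) * prior` on `Θ`.

*Convergence of derivatives.* A pointwise convergent sequence of functions with uniformly bounded
third derivatives converges locally uniformly together with its first two derivatives
(`HasJetOn.exists_limit`): up to `O(t)`, uniformly in `n`, the second derivatives are second
difference quotients with step `t`, so they converge along the diagonal, hence by polarization; the
first derivatives follow from the Taylor formula, and the Taylor bounds pass to the limit. The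
conclusion is recorded as `TendstoC2At`, joint convergence along `atTop ×ˢ 𝓝 a`, which is stable
under composition and hence passes from `l_n` and `ẑ_n` to `f n` (`TendstoC2At.profile`).

*The maximum.* The limit `g` has a strict maximum over `K` at `λ₀`. As `l_*` is stationary in `ζ` at
`(λ₀, z_* λ₀)`, the second derivative of `z_*` drops out of `g''`, which is the negative definite
Hessian of `l_*` restricted to the tangent space of the graph of `z_*` (`fderiv_fderiv_profile`).
Hence the `f n` are uniformly strongly concave near `λ₀`, and their maximizers `λ_n` on a small ball
are critical points converging to `λ₀` (`TendstoC2At.exists_critical_points`).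

*Laplace's method.* The unnormalized density of `√n (λ - λ_n)` converges pointwise to
`prior λ₀ * exp (g'' (u, u) / 2)` by Taylor's formula at `λ_n`. Near `λ_n` strong concavity provides
an integrable Gaussian bound; away from it `f n ≤ f n λ_n - η`, and the contribution is at most
`n ^ (d / 2) * exp (-n η)`. This gives convergence in `L¹`
(`tendsto_integral_abs_rescaledDensity_sub`), which bounds the total variation distance once both
measures are normalized (`tvDist_le_of_eq_smul_withDensity`). Normalizing constants and Jacobians
never need to be computed: it suffices that each measure involved is a probability measure with
density proportional to a known function
(`exists_multivariateGaussian_eq_smul_withDensity`, `posterior_and_rescaledLaw`).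
-/

namespace BridgedPosterior

/-! ### Taylor bounds for functions with Lipschitz second derivative -/

section Jets

variable {X F : Type*} [NormedAddCommGroup X] [NormedSpace ℝ X]
  [NormedAddCommGroup F] [NormedSpace ℝ F]

/-- On `s`, the maps `f'` and `f''` are the first two derivatives of `f`, and `f''` is
`M`-Lipschitz. -/
structure HasJetOn (f : X → F) (f' : X → X →L[ℝ] F) (f'' : X → X →L[ℝ] X →L[ℝ] F) (M : ℝ)
    (s : Set X) : Prop where
  hasFDerivAt : ∀ x ∈ s, HasFDerivAt f (f' x) x
  hasFDerivAt' : ∀ x ∈ s, HasFDerivAt f' (f'' x) x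
  lipschitz : ∀ x ∈ s, ∀ y ∈ s, ‖f'' y - f'' x‖ ≤ M * ‖y - x‖

namespace HasJetOn

variable {f : X → F} {f' : X → X →L[ℝ] F} {f'' : X → X →L[ℝ] X →L[ℝ] F} {M : ℝ} {s : Set X}

theorem symm (h : HasJetOn f f' f'' M s) (hs : IsOpen s) {x : X} (hx : x ∈ s) (v w : X) :
    f'' x v w = f'' x w v :=
  second_derivative_symmetric_of_eventually
    (by filter_upwards [hs.mem_nhds hx] with y hy using h.hasFDerivAt y hy)
    (h.hasFDerivAt' x hx) v w

theorem norm_deriv_sub_le (h : HasJetOn f f' f'' M s) (hM : 0 ≤ M) (hs : Convex ℝ s) {x y : X}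
    (hx : x ∈ s) (hy : y ∈ s) :
    ‖f' y - f' x - f'' x (y - x)‖ ≤ M * ‖y - x‖ ^ 2 := by
  have hsub : segment ℝ x y ⊆ s := hs.segment_subset hx hy
  have key := Convex.norm_image_sub_le_of_norm_hasFDerivWithin_le (𝕜 := ℝ)
    (f := fun w => f' w - f'' x w) (f' := fun w => f'' w - f'' x) (s := segment ℝ x y)
    (C := M * ‖y - x‖) (x := x) (y := y)
    (fun w hw => ((h.hasFDerivAt' w (hsub hw)).sub (f'' x).hasFDerivAt).hasFDerivWithinAt)
    (fun w hw => (h.lipschitz x hx w (hsub hw)).trans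
      (mul_le_mul_of_nonneg_left (norm_sub_le_of_mem_segment hw) hM))
    (convex_segment x y) (left_mem_segment ℝ x y) (right_mem_segment ℝ x y)
  calc _ = ‖f' y - f'' x y - (f' x - f'' x x)‖ := by rw [map_sub]; congr 1; abel
    _ ≤ _ := key
    _ = _ := by ring

theorem norm_sub_le (h : HasJetOn f f' f'' M s) (hM : 0 ≤ M) (hs : Convex ℝ s) (hso : IsOpen s)
    {x y : X} (hx : x ∈ s) (hy : y ∈ s) :
    ‖f y - f x - f' x (y - x) - (2⁻¹ : ℝ) • f'' x (y - x) (y - x)‖ ≤ M * ‖y - x‖ ^ 3 := by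
  have hsub : segment ℝ x y ⊆ s := hs.segment_subset hx hy
  have hquad : ∀ w, HasFDerivAt (fun w => (2⁻¹ : ℝ) • f'' x (w - x) (w - x)) (f'' x (w - x)) w := by
    intro w
    have h1 : HasFDerivAt (fun w => w - x) (ContinuousLinearMap.id ℝ X) w :=
      (hasFDerivAt_id w).sub_const x
    have h2 := (((f'' x).hasFDerivAt.comp w h1).clm_apply h1).const_smul (2⁻¹ : ℝ)
    refine h2.congr_fderiv ?_
    ext v
    simp only [smul_apply, add_apply,
      ContinuousLinearMap.comp_apply, ContinuousLinearMap.flip_apply, Function.comp_apply,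
      ContinuousLinearMap.id_apply]
    rw [h.symm hso hx v (w - x), ← two_smul ℝ, smul_smul]
    norm_num
  have key := Convex.norm_image_sub_le_of_norm_hasFDerivWithin_le (𝕜 := ℝ)
    (f := fun w => f w - f' x w - (2⁻¹ : ℝ) • f'' x (w - x) (w - x))
    (f' := fun w => f' w - f' x - f'' x (w - x)) (s := segment ℝ x y)
    (C := M * ‖y - x‖ ^ 2) (x := x) (y := y)
    (fun w hw => (((h.hasFDerivAt w (hsub hw)).sub (f' x).hasFDerivAt).sub
      (hquad w)).hasFDerivWithinAt)
    (fun w hw => (h.norm_deriv_sub_le hM hs hx (hsub hw)).trans (by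
      have := norm_sub_le_of_mem_segment hw
      gcongr))
    (convex_segment x y) (left_mem_segment ℝ x y) (right_mem_segment ℝ x y)
  calc _ = ‖f y - f' x y - (2⁻¹ : ℝ) • f'' x (y - x) (y - x)
        - (f x - f' x x - (2⁻¹ : ℝ) • f'' x (x - x) (x - x))‖ := by
        rw [map_sub (f' x), sub_self, map_zero, smul_zero]; congr 1; abel
    _ ≤ _ := key
    _ = _ := by ring

end HasJetOn

/-- The first two derivatives of a `C³` function with `‖f'''‖ ≤ M` on an open convex set. -/
theorem HasJetOn.of_contDiffOn {f : X → F} {M : ℝ} {s : Set X} (hso : IsOpen s) (hs : Convex ℝ s)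
    (hf : ContDiffOn ℝ 3 f s) (hM : ∀ x ∈ s, ‖iteratedFDeriv ℝ 3 f x‖ ≤ M) :
    HasJetOn f (fderiv ℝ f) (fderiv ℝ (fderiv ℝ f)) M s := by
  have h1 : ContDiffOn ℝ 2 (fderiv ℝ f) s := hf.fderiv_of_isOpen hso (by norm_num)
  have h2 : ContDiffOn ℝ 1 (fderiv ℝ (fderiv ℝ f)) s := h1.fderiv_of_isOpen hso (by norm_num)
  have hd : ∀ x ∈ s, HasFDerivAt (fderiv ℝ (fderiv ℝ f)) (fderiv ℝ (fderiv ℝ (fderiv ℝ f)) x) x :=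
    fun x hx => ((h2.contDiffAt (hso.mem_nhds hx)).differentiableAt (by norm_num)).hasFDerivAt
  refine ⟨fun x hx =>
      ((hf.contDiffAt (hso.mem_nhds hx)).differentiableAt (by norm_num)).hasFDerivAt,
    fun x hx => ((h1.contDiffAt (hso.mem_nhds hx)).differentiableAt (by norm_num)).hasFDerivAt,
    fun x hx y hy => ?_⟩
  refine Convex.norm_image_sub_le_of_norm_hasFDerivWithin_le (𝕜 := ℝ)
    (f' := fderiv ℝ (fderiv ℝ (fderiv ℝ f)))
    (fun w hw => (hd w hw).hasFDerivWithinAt) (fun w hw => ?_) hs hx hy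
  have := hM w hw
  rwa [← norm_iteratedFDeriv_fderiv, ← norm_iteratedFDeriv_fderiv, ← norm_iteratedFDeriv_fderiv,
    norm_iteratedFDeriv_zero] at this

/-! ### Pointwise convergence with uniformly Lipschitz second derivatives -/

theorem tendsto_clm_apply {α : Type*} {l : Filter α} {T : α → X →L[ℝ] F} {S : X →L[ℝ] F}
    {u : α → X} {v : X} (hT : Tendsto T l (𝓝 S)) (hu : Tendsto u l (𝓝 v)) :
    Tendsto (fun a => T a (u a)) l (𝓝 (S v)) :=
  (isBoundedBilinearMap_apply.continuous.tendsto (S, v)).comp (hT.prodMk_nhds hu)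

theorem cauchySeq_of_forall_approx {F : Type*} [SeminormedAddCommGroup F] {a : ℕ → F}
    (h : ∀ ε > 0, ∃ b : ℕ → F, CauchySeq b ∧ ∀ᶠ n in atTop, ‖a n - b n‖ ≤ ε) : CauchySeq a := by
  rw [Metric.cauchySeq_iff]
  intro ε hε
  obtain ⟨b, hb, hab⟩ := h (ε / 4) (by positivity)
  obtain ⟨N₁, hN₁⟩ := Metric.cauchySeq_iff.1 hb (ε / 4) (by positivity)
  obtain ⟨N₂, hN₂⟩ := eventually_atTop.1 hab
  refine ⟨max N₁ N₂, fun m hm n hn => ?_⟩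
  have h1 := hN₁ m (le_of_max_le_left hm) n (le_of_max_le_left hn)
  have h2 := hN₂ m (le_of_max_le_right hm)
  have h3 := hN₂ n (le_of_max_le_right hn)
  rw [← dist_eq_norm] at h2 h3
  rw [dist_comm] at h3
  linarith [dist_triangle4 (a m) (b m) (b n) (a n)]

/-- On a finite-dimensional space, pointwise convergent sequences of continuous linear maps
converge in operator norm. -/
theorem exists_tendsto_clm_of_forall_cauchySeq [FiniteDimensional ℝ X] [CompleteSpace F]
    {T : ℕ → X →L[ℝ] F} (h : ∀ v, CauchySeq fun n => T n v) : ∃ S, Tendsto T atTop (𝓝 S) := by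
  refine cauchySeq_tendsto_of_complete ?_
  obtain ⟨C, hC, hT⟩ := (Module.finBasis ℝ X).exists_opNorm_le (F := F)
  rw [Metric.cauchySeq_iff]
  intro ε hε
  have h' : ∀ᶠ N in atTop, ∀ i, ∀ m ≥ N, ∀ n ≥ N,
      dist (T m (Module.finBasis ℝ X i)) (T n (Module.finBasis ℝ X i)) < ε / (2 * C) := by
    rw [eventually_all]
    intro i
    obtain ⟨N, hN⟩ := Metric.cauchySeq_iff.1 (h (Module.finBasis ℝ X i)) (ε / (2 * C))
      (by positivity)
    filter_upwards [eventually_ge_atTop N] with K hK m hm n hn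
    exact hN m (hK.trans hm) n (hK.trans hn)
  obtain ⟨N, hN⟩ := h'.exists
  refine ⟨N, fun m hm n hn => ?_⟩
  rw [dist_eq_norm]
  refine (hT (M := ε / (2 * C)) (by positivity) fun i => ?_).trans_lt ?_
  · rw [sub_apply, ← dist_eq_norm]
    exact (hN i m hm n hn).le
  · rw [show C * (ε / (2 * C)) = ε / 2 by field_simp]
    linarith

theorem exists_pos_forall_add_smul_mem {s : Set X} (hso : IsOpen s) {x : X} (hx : x ∈ s) (v : X) :
    ∃ r > 0, ∀ t : ℝ, |t| < r → x + t • v ∈ s := by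
  have : ∀ᶠ t : ℝ in 𝓝 0, x + t • v ∈ s := by
    refine ContinuousAt.eventually_mem (by fun_prop) ?_
    simpa using hso.mem_nhds hx
  obtain ⟨r, hr, h⟩ := Metric.eventually_nhds_iff.1 this
  exact ⟨r, hr, fun t ht => h (by simpa using ht)⟩

variable {f : ℕ → X → F} {f' : ℕ → X → X →L[ℝ] F} {f'' : ℕ → X → X →L[ℝ] X →L[ℝ] F}
  {g : X → F} {M : ℝ} {s : Set X}

/-- The second derivatives along a line are, up to `O(t)` uniformly in `n`, second difference
quotients with step `t`, which converge. -/
theorem cauchySeq_second_deriv_diag (hso : IsOpen s) (hs : Convex ℝ s) (hM : 0 ≤ M)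
    (hf : ∀ᶠ n in atTop, HasJetOn (f n) (f' n) (f'' n) M s)
    (hlim : ∀ x ∈ s, Tendsto (fun n => f n x) atTop (𝓝 (g x))) {x : X} (hx : x ∈ s) (v : X) :
    CauchySeq fun n => f'' n x v v := by
  refine cauchySeq_of_forall_approx fun ε hε => ?_
  obtain ⟨r, hr, hrs⟩ := exists_pos_forall_add_smul_mem hso hx v
  obtain ⟨t, ht0, htr, htε⟩ : ∃ t : ℝ, 0 < t ∧ t < r ∧ 2 * M * ‖v‖ ^ 3 * t ≤ ε := by
    refine ⟨min (r / 2) (ε / (2 * M * ‖v‖ ^ 3 + 1)), by positivity, ?_, ?_⟩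
    · exact (min_le_left _ _).trans_lt (by linarith)
    · calc _ ≤ (2 * M * ‖v‖ ^ 3 + 1) * (ε / (2 * M * ‖v‖ ^ 3 + 1)) := by
            gcongr
            · linarith
            · exact min_le_right _ _
        _ = ε := by field_simp
  have hp : x + t • v ∈ s := hrs t (by rwa [abs_of_pos ht0])
  have hm : x + (-t) • v ∈ s := hrs (-t) (by rwa [abs_neg, abs_of_pos ht0])
  refine ⟨fun n => (t ^ 2)⁻¹ • (f n (x + t • v) + f n (x + (-t) • v) - (2 : ℝ) • f n x), ?_, ?_⟩
  · exact ((((hlim _ hp).add (hlim _ hm)).sub ((hlim _ hx).const_smul (2 : ℝ))).const_smul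
      _).cauchySeq
  · filter_upwards [hf] with n hn
    have h1 := hn.norm_sub_le hM hs hso hx hp
    have h2 := hn.norm_sub_le hM hs hso hx hm
    simp only [add_sub_cancel_left, map_smul, smul_apply, norm_smul,
      Real.norm_eq_abs, abs_neg, abs_of_pos ht0] at h1 h2
    have e : f'' n x v v
        - (t ^ 2)⁻¹ • (f n (x + t • v) + f n (x + (-t) • v) - (2 : ℝ) • f n x)
        = -((t ^ 2)⁻¹ • ((f n (x + t • v) - f n x - t • f' n x v
            - (2⁻¹ : ℝ) • t • t • f'' n x v v)
          + (f n (x + (-t) • v) - f n x - (-t) • f' n x v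
            - (2⁻¹ : ℝ) • (-t) • (-t) • f'' n x v v))) := by
      have ht : (t ^ 2)⁻¹ * t ^ 2 = 1 := by field_simp
      match_scalars <;> field_simp <;> ring
    rw [e, norm_neg, norm_smul, norm_inv, norm_pow, Real.norm_eq_abs, abs_of_pos ht0]
    calc _ ≤ (t ^ 2)⁻¹ * (M * (t * ‖v‖) ^ 3 + M * (t * ‖v‖) ^ 3) := by
          gcongr
          exact (norm_add_le _ _).trans (add_le_add h1 h2)
      _ = 2 * M * ‖v‖ ^ 3 * t := by field_simp; ring
      _ ≤ ε := htε

/-- The second derivatives are symmetric, so convergence on the diagonal gives convergence by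
polarization. -/
theorem exists_tendsto_second_deriv [FiniteDimensional ℝ X] [CompleteSpace F]
    (hso : IsOpen s) (hs : Convex ℝ s) (hM : 0 ≤ M)
    (hf : ∀ᶠ n in atTop, HasJetOn (f n) (f' n) (f'' n) M s)
    (hlim : ∀ x ∈ s, Tendsto (fun n => f n x) atTop (𝓝 (g x))) {x : X} (hx : x ∈ s) :
    ∃ B, Tendsto (fun n => f'' n x) atTop (𝓝 B) := by
  refine exists_tendsto_clm_of_forall_cauchySeq fun v =>
    (exists_tendsto_clm_of_forall_cauchySeq fun w => ?_).choose_spec.cauchySeq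
  have hd := cauchySeq_second_deriv_diag hso hs hM hf hlim hx
  obtain ⟨a, ha⟩ := cauchySeq_tendsto_of_complete (hd (v + w))
  obtain ⟨b, hb⟩ := cauchySeq_tendsto_of_complete (hd v)
  obtain ⟨c, hc⟩ := cauchySeq_tendsto_of_complete (hd w)
  refine (Tendsto.congr' ?_ (((ha.sub hb).sub hc).const_smul (2⁻¹ : ℝ))).cauchySeq
  filter_upwards [hf] with n hn
  simp only [map_add, add_apply]
  rw [hn.symm hso hx w v]
  match_scalars <;> norm_num

/-- Up to `O(t²)` uniformly in `n`, the first derivatives are difference quotients corrected by the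
second-order term, whose convergence is already known. -/
theorem exists_tendsto_deriv [FiniteDimensional ℝ X] [CompleteSpace F]
    (hso : IsOpen s) (hs : Convex ℝ s) (hM : 0 ≤ M)
    (hf : ∀ᶠ n in atTop, HasJetOn (f n) (f' n) (f'' n) M s)
    (hlim : ∀ x ∈ s, Tendsto (fun n => f n x) atTop (𝓝 (g x))) {x : X} (hx : x ∈ s) :
    ∃ A, Tendsto (fun n => f' n x) atTop (𝓝 A) := by
  obtain ⟨B, hB⟩ := exists_tendsto_second_deriv hso hs hM hf hlim hx
  refine exists_tendsto_clm_of_forall_cauchySeq fun v => cauchySeq_of_forall_approx fun ε hε => ?_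
  obtain ⟨r, hr, hrs⟩ := exists_pos_forall_add_smul_mem hso hx v
  obtain ⟨t, ht0, ht1, htr, htε⟩ :
      ∃ t : ℝ, 0 < t ∧ t ≤ 1 ∧ t < r ∧ M * ‖v‖ ^ 3 * t ≤ ε := by
    refine ⟨min 1 (min (r / 2) (ε / (M * ‖v‖ ^ 3 + 1))), by positivity, min_le_left _ _, ?_, ?_⟩
    · exact ((min_le_right _ _).trans (min_le_left _ _)).trans_lt (by linarith)
    · calc _ ≤ (M * ‖v‖ ^ 3 + 1) * (ε / (M * ‖v‖ ^ 3 + 1)) := by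
            gcongr
            · linarith
            · exact (min_le_right _ _).trans (min_le_right _ _)
        _ = ε := by field_simp
  have hp : x + t • v ∈ s := hrs t (by rwa [abs_of_pos ht0])
  refine ⟨fun n => t⁻¹ • (f n (x + t • v) - f n x - (2⁻¹ : ℝ) • t • t • f'' n x v v), ?_, ?_⟩
  · have hBv : Tendsto (fun n => f'' n x v v) atTop (𝓝 (B v v)) :=
      tendsto_clm_apply (tendsto_clm_apply hB tendsto_const_nhds) tendsto_const_nhds
    exact ((((hlim _ hp).sub (hlim _ hx)).sub
      (((hBv.const_smul t).const_smul t).const_smul (2⁻¹ : ℝ))).const_smul t⁻¹).cauchySeq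
  · filter_upwards [hf] with n hn
    have h1 := hn.norm_sub_le hM hs hso hx hp
    simp only [add_sub_cancel_left, map_smul, smul_apply, norm_smul,
      Real.norm_eq_abs, abs_of_pos ht0] at h1
    have e : f' n x v - t⁻¹ • (f n (x + t • v) - f n x - (2⁻¹ : ℝ) • t • t • f'' n x v v)
        = -(t⁻¹ • (f n (x + t • v) - f n x - t • f' n x v
            - (2⁻¹ : ℝ) • t • t • f'' n x v v)) := by
      match_scalars <;> field_simp
    rw [e, norm_neg, norm_smul, norm_inv, Real.norm_eq_abs, abs_of_pos ht0]
    calc _ ≤ t⁻¹ * (M * (t * ‖v‖) ^ 3) := by gcongr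
      _ = M * ‖v‖ ^ 3 * t * t := by field_simp
      _ ≤ M * ‖v‖ ^ 3 * t * 1 := by gcongr
      _ ≤ ε := by rwa [mul_one]

/-- If `f n → g` pointwise on an open convex set, and the second derivatives of the `f n` are
Lipschitz with a common constant, then `g` is twice differentiable, and the first two derivatives
converge jointly in `n` and the point. -/
theorem HasJetOn.exists_limit [FiniteDimensional ℝ X] [CompleteSpace F]
    (hso : IsOpen s) (hs : Convex ℝ s) (hM : 0 ≤ M)
    (hf : ∀ᶠ n in atTop, HasJetOn (f n) (f' n) (f'' n) M s)
    (hlim : ∀ x ∈ s, Tendsto (fun n => f n x) atTop (𝓝 (g x))) :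
    ∃ (g' : X → X →L[ℝ] F) (g'' : X → X →L[ℝ] X →L[ℝ] F), HasJetOn g g' g'' M s ∧ ∀ x ∈ s,
      Tendsto (fun q : ℕ × X => f q.1 q.2) (atTop ×ˢ 𝓝 x) (𝓝 (g x)) ∧
      Tendsto (fun q : ℕ × X => f' q.1 q.2) (atTop ×ˢ 𝓝 x) (𝓝 (g' x)) ∧
      Tendsto (fun q : ℕ × X => f'' q.1 q.2) (atTop ×ˢ 𝓝 x) (𝓝 (g'' x)) := by
  have hA : ∀ x, ∃ A, x ∈ s → Tendsto (fun n => f' n x) atTop (𝓝 A) := fun x => by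
    by_cases hx : x ∈ s
    · obtain ⟨A, hA⟩ := exists_tendsto_deriv hso hs hM hf hlim hx
      exact ⟨A, fun _ => hA⟩
    · exact ⟨0, fun h => (hx h).elim⟩
  have hB : ∀ x, ∃ B, x ∈ s → Tendsto (fun n => f'' n x) atTop (𝓝 B) := fun x => by
    by_cases hx : x ∈ s
    · obtain ⟨A, hA⟩ := exists_tendsto_second_deriv hso hs hM hf hlim hx
      exact ⟨A, fun _ => hA⟩
    · exact ⟨0, fun h => (hx h).elim⟩
  choose g' hg' using hA
  choose g'' hg'' using hB
  have b1 : ∀ x ∈ s, ∀ y ∈ s, ‖g y - g x - g' x (y - x) - (2⁻¹ : ℝ) • g'' x (y - x) (y - x)‖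
      ≤ M * ‖y - x‖ ^ 3 := fun x hx y hy =>
    le_of_tendsto ((((hlim y hy).sub (hlim x hx)).sub
        (tendsto_clm_apply (hg' x hx) tendsto_const_nhds)).sub
        ((tendsto_clm_apply (tendsto_clm_apply (hg'' x hx) tendsto_const_nhds)
          tendsto_const_nhds).const_smul (2⁻¹ : ℝ))).norm
      (hf.mono fun n hn => hn.norm_sub_le hM hs hso hx hy)
  have b2 : ∀ x ∈ s, ∀ y ∈ s, ‖g' y - g' x - g'' x (y - x)‖ ≤ M * ‖y - x‖ ^ 2 :=
    fun x hx y hy =>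
    le_of_tendsto (((hg' y hy).sub (hg' x hx)).sub
        (tendsto_clm_apply (hg'' x hx) tendsto_const_nhds)).norm
      (hf.mono fun n hn => hn.norm_deriv_sub_le hM hs hx hy)
  refine ⟨g', g'', ⟨fun x hx => ?_, fun x hx => ?_, fun x hx y hy => ?_⟩, fun x hx => ?_⟩
  · refine .of_isLittleO ?_
    have h0 : (fun y => g y - g x - g' x (y - x)) =O[𝓝 x] fun y => ‖y - x‖ ^ 2 := by
      refine Asymptotics.IsBigO.of_bound (M + 2⁻¹ * ‖g'' x‖) ?_
      filter_upwards [hso.mem_nhds hx, Metric.ball_mem_nhds x one_pos] with y hy hy1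
      have h1 : ‖y - x‖ ≤ 1 := by rw [← dist_eq_norm]; exact (Metric.mem_ball.1 hy1).le
      have h2 : ‖g'' x (y - x) (y - x)‖ ≤ ‖g'' x‖ * ‖y - x‖ * ‖y - x‖ :=
        (g'' x).le_opNorm₂ _ _
      have h3 := b1 x hx y hy
      have h4 : ‖g y - g x - g' x (y - x)‖ ≤
          ‖g y - g x - g' x (y - x) - (2⁻¹ : ℝ) • g'' x (y - x) (y - x)‖
            + ‖(2⁻¹ : ℝ) • g'' x (y - x) (y - x)‖ := by
        simpa using norm_add_le (g y - g x - g' x (y - x) - (2⁻¹ : ℝ) • g'' x (y - x) (y - x))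
          ((2⁻¹ : ℝ) • g'' x (y - x) (y - x))
      rw [norm_smul, Real.norm_of_nonneg (by norm_num : (0 : ℝ) ≤ 2⁻¹)] at h4
      have h5 : M * ‖y - x‖ ^ 3 ≤ M * ‖y - x‖ ^ 2 :=
        mul_le_mul_of_nonneg_left (pow_le_pow_of_le_one (norm_nonneg _) h1 (by norm_num)) hM
      rw [norm_pow, norm_norm]
      nlinarith
    exact h0.trans_isLittleO (Asymptotics.isLittleO_pow_sub_sub x one_lt_two)
  · refine .of_isLittleO ?_
    have h0 : (fun y => g' y - g' x - g'' x (y - x)) =O[𝓝 x] fun y => ‖y - x‖ ^ 2 := by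
      refine Asymptotics.IsBigO.of_bound M ?_
      filter_upwards [hso.mem_nhds hx] with y hy
      rw [norm_pow, norm_norm]
      exact b2 x hx y hy
    exact h0.trans_isLittleO (Asymptotics.isLittleO_pow_sub_sub x one_lt_two)
  · have h : Tendsto (fun n => ‖f'' n y - f'' n x‖) atTop (𝓝 ‖g'' y - g'' x‖) :=
      Tendsto.norm (E := X →L[ℝ] X →L[ℝ] F) ((hg'' y hy).sub (hg'' x hx))
    exact le_of_tendsto h (hf.mono fun n hn => hn.lipschitz x hx y hy)
  · -- On `atTop ×ˢ 𝓝 x` the increments `q.2 - x` tend to `0`, uniformly in `q.1`.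
    have hq : Tendsto (fun q : ℕ × X => q.2 - x) (atTop ×ˢ 𝓝 x) (𝓝 0) := by
      have := (tendsto_snd (f := (atTop : Filter ℕ)) (g := 𝓝 x)).sub_const x
      rwa [sub_self] at this
    have hqn : Tendsto (fun q : ℕ × X => ‖q.2 - x‖) (atTop ×ˢ 𝓝 x) (𝓝 0) := by
      simpa using hq.norm
    have hev : ∀ᶠ q : ℕ × X in atTop ×ˢ 𝓝 x, HasJetOn (f q.1) (f' q.1) (f'' q.1) M s ∧ q.2 ∈ s :=
      hf.prod_mk (hso.mem_nhds hx)
    have hl0 : Tendsto (fun q : ℕ × X => f q.1 x) (atTop ×ˢ 𝓝 x) (𝓝 (g x)) :=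
      (hlim x hx).comp tendsto_fst
    have hl1 : Tendsto (fun q : ℕ × X => f' q.1 x) (atTop ×ˢ 𝓝 x) (𝓝 (g' x)) :=
      (hg' x hx).comp tendsto_fst
    have hl2 : Tendsto (fun q : ℕ × X => f'' q.1 x) (atTop ×ˢ 𝓝 x) (𝓝 (g'' x)) :=
      (hg'' x hx).comp tendsto_fst
    refine ⟨?_, ?_, ?_⟩
    · have hz : Tendsto (fun q : ℕ × X => f q.1 q.2 - f q.1 x - f' q.1 x (q.2 - x)
          - (2⁻¹ : ℝ) • f'' q.1 x (q.2 - x) (q.2 - x)) (atTop ×ˢ 𝓝 x) (𝓝 0) :=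
        squeeze_zero_norm' (hev.mono fun q h => h.1.norm_sub_le hM hs hso hx h.2)
          (by simpa using (hqn.pow 3).const_mul M)
      have := ((hz.add ((tendsto_clm_apply (tendsto_clm_apply hl2 hq) hq).const_smul (2⁻¹ : ℝ))).add
        (tendsto_clm_apply hl1 hq)).add hl0
      simpa using this
    · have hz : Tendsto (fun q : ℕ × X => f' q.1 q.2 - f' q.1 x - f'' q.1 x (q.2 - x))
          (atTop ×ˢ 𝓝 x) (𝓝 0) :=
        squeeze_zero_norm' (hev.mono fun q h => h.1.norm_deriv_sub_le hM hs hx h.2)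
          (by simpa using (hqn.pow 2).const_mul M)
      have := (hz.add (tendsto_clm_apply hl2 hq)).add hl1
      simpa using this
    · have hz : Tendsto (fun q : ℕ × X => f'' q.1 q.2 - f'' q.1 x) (atTop ×ˢ 𝓝 x) (𝓝 0) := by
        refine (tendsto_zero_iff_norm_tendsto_zero (E := X →L[ℝ] X →L[ℝ] F)).2 ?_
        refine squeeze_zero' (Eventually.of_forall fun _ => norm_nonneg _)
          (hev.mono fun q h => h.1.lipschitz x hx q.2 h.2) ?_
        simpa using hqn.const_mul M
      simpa using hz.add hl2

end Jets

/-! ### Joint convergence of functions with their first two derivatives -/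

section TendstoC2At

variable {X Y G : Type*} [NormedAddCommGroup X] [NormedSpace ℝ X]
  [NormedAddCommGroup Y] [NormedSpace ℝ Y] [NormedAddCommGroup G] [NormedSpace ℝ G]

/-- The functions `f n` are `C²` at `x` for all large `n` and all `x` in a common neighborhood of
`a`, the function `g` is `C²` at `a`, and
`f n x`, `(f n)' x`, `(f n)'' x` tend to `g a`, `g' a`, `g'' a` as `n → ∞` and `x → a` jointly.
This is local uniform convergence up to second order, in a form which composes well. -/
structure TendstoC2At (f : ℕ → X → G) (g : X → G) (a : X) : Prop where
  contDiffAt : ∀ᶠ q : ℕ × X in atTop ×ˢ 𝓝 a, ContDiffAt ℝ 2 (f q.1) q.2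
  contDiffAt_limit : ContDiffAt ℝ 2 g a
  tendsto : Tendsto (fun q : ℕ × X => f q.1 q.2) (atTop ×ˢ 𝓝 a) (𝓝 (g a))
  tendsto_fderiv :
    Tendsto (fun q : ℕ × X => fderiv ℝ (f q.1) q.2) (atTop ×ˢ 𝓝 a) (𝓝 (fderiv ℝ g a))
  tendsto_fderiv_fderiv :
    Tendsto (fun q : ℕ × X => fderiv ℝ (fderiv ℝ (f q.1)) q.2) (atTop ×ˢ 𝓝 a)
      (𝓝 (fderiv ℝ (fderiv ℝ g) a))

theorem HasJetOn.contDiffOn {f : X → G} {f' : X → X →L[ℝ] G} {f'' : X → X →L[ℝ] X →L[ℝ] G}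
    {M : ℝ} {s : Set X} (h : HasJetOn f f' f'' M s) (hso : IsOpen s) : ContDiffOn ℝ 2 f s := by
  have e1 : ∀ x ∈ s, fderiv ℝ f x = f' x := fun x hx => (h.hasFDerivAt x hx).fderiv
  have e2 : ∀ x ∈ s, fderiv ℝ f' x = f'' x := fun x hx => (h.hasFDerivAt' x hx).fderiv
  have hc : ContinuousOn f'' s := by
    intro x hx
    have : Tendsto (fun y => M * ‖y - x‖) (𝓝[s] x) (𝓝 0) := by
      have : Continuous fun y => M * ‖y - x‖ := by fun_prop
      simpa using (this.tendsto x).mono_left nhdsWithin_le_nhds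
    refine (tendsto_iff_norm_sub_tendsto_zero (E := X →L[ℝ] X →L[ℝ] G)).2
      (squeeze_zero' (.of_forall fun _ => by positivity) ?_ this)
    filter_upwards [self_mem_nhdsWithin] with y hy using h.lipschitz x hx y hy
  have c1 : ContDiffOn ℝ 1 f' s := by
    rw [show (1 : WithTop ℕ∞) = 0 + 1 by norm_num, contDiffOn_succ_iff_fderiv_of_isOpen hso]
    refine ⟨fun x hx => (h.hasFDerivAt' x hx).differentiableAt.differentiableWithinAt,
      by simp, contDiffOn_zero.2 (hc.congr e2)⟩
  rw [show (2 : WithTop ℕ∞) = 1 + 1 by norm_num, contDiffOn_succ_iff_fderiv_of_isOpen hso]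
  exact ⟨fun x hx => (h.hasFDerivAt x hx).differentiableAt.differentiableWithinAt,
    by simp, c1.congr e1⟩

/-- Pointwise convergence on an open convex set upgrades to convergence with two derivatives as
soon as the third derivatives are uniformly bounded. -/
theorem TendstoC2At.of_bounded_third_deriv [FiniteDimensional ℝ X] [CompleteSpace G]
    {f : ℕ → X → G} {g : X → G} {M : ℝ} {s : Set X} (hso : IsOpen s) (hs : Convex ℝ s)
    (hf : ∀ᶠ n in atTop, ContDiffOn ℝ 3 (f n) s ∧ ∀ x ∈ s, ‖iteratedFDeriv ℝ 3 (f n) x‖ ≤ M)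
    (hlim : ∀ x ∈ s, Tendsto (fun n => f n x) atTop (𝓝 (g x))) {a : X} (ha : a ∈ s) :
    TendstoC2At f g a := by
  have hM : 0 ≤ M := by
    obtain ⟨n, hn⟩ := hf.exists
    exact (norm_nonneg _).trans (hn.2 a ha)
  obtain ⟨g', g'', hg, h⟩ := HasJetOn.exists_limit hso hs hM
    (hf.mono fun n hn => HasJetOn.of_contDiffOn hso hs hn.1 hn.2) hlim
  obtain ⟨h0, h1, h2⟩ := h a ha
  have e1 : fderiv ℝ g =ᶠ[𝓝 a] g' := by
    filter_upwards [hso.mem_nhds ha] with x hx using (hg.hasFDerivAt x hx).fderiv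
  refine ⟨?_, (hg.contDiffOn hso).contDiffAt (hso.mem_nhds ha), h0, ?_, ?_⟩
  · filter_upwards [hf.prod_mk (hso.mem_nhds ha)] with q hq
    exact (hq.1.1.contDiffAt (hso.mem_nhds hq.2)).of_le (by norm_num)
  · rwa [e1.eq_of_nhds]
  · rwa [e1.fderiv_eq, (hg.hasFDerivAt' a ha).fderiv]

theorem tendsto_clm_comp {α : Type*} {l : Filter α} {T : α → Y →L[ℝ] G} {S : Y →L[ℝ] G}
    {U : α → X →L[ℝ] Y} {V : X →L[ℝ] Y} (hT : Tendsto T l (𝓝 S)) (hU : Tendsto U l (𝓝 V)) :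
    Tendsto (fun a => (T a).comp (U a)) l (𝓝 (S.comp V)) :=
  (isBoundedBilinearMap_comp.continuous.tendsto (S, V)).comp (hT.prodMk_nhds hU)

theorem ContDiffAt.hasFDerivAt_fderiv {l : X → G} {x : X} (hl : ContDiffAt ℝ 2 l x) :
    HasFDerivAt (fderiv ℝ l) (fderiv ℝ (fderiv ℝ l) x) x :=
  ((hl.fderiv_right (m := 1) (by norm_num)).differentiableAt (by norm_num)).hasFDerivAt

theorem ContDiffAt.eventually_hasFDerivAt {l : X → G} {x : X} (hl : ContDiffAt ℝ 2 l x) :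
    ∀ᶠ y in 𝓝 x, HasFDerivAt l (fderiv ℝ l y) y := by
  filter_upwards [hl.eventually (by simp)] with y hy
  exact (hy.differentiableAt (by norm_num)).hasFDerivAt

theorem fderiv_fderiv_comp {l : Y → G} {φ : X → Y} {x : X} (hl : ContDiffAt ℝ 2 l (φ x))
    (hφ : ContDiffAt ℝ 2 φ x) :
    fderiv ℝ (fderiv ℝ fun x => l (φ x)) x =
      (ContinuousLinearMap.compL ℝ X Y G (fderiv ℝ l (φ x))).comp (fderiv ℝ (fderiv ℝ φ) x) +
      ((ContinuousLinearMap.compL ℝ X Y G).flip (fderiv ℝ φ x)).comp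
        ((fderiv ℝ (fderiv ℝ l) (φ x)).comp (fderiv ℝ φ x)) := by
  have e : (fderiv ℝ fun x => l (φ x)) =ᶠ[𝓝 x]
      fun y => (fderiv ℝ l (φ y)).comp (fderiv ℝ φ y) := by
    filter_upwards [ContDiffAt.eventually_hasFDerivAt hφ,
      hφ.continuousAt.eventually (ContDiffAt.eventually_hasFDerivAt hl)] with y h1 h2
    exact (h2.comp y h1).fderiv
  rw [e.fderiv_eq]
  have h1 : HasFDerivAt φ (fderiv ℝ φ x) x := (hφ.differentiableAt (by norm_num)).hasFDerivAt
  exact (((ContDiffAt.hasFDerivAt_fderiv hl).comp x h1).clm_comp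
    (ContDiffAt.hasFDerivAt_fderiv hφ)).fderiv

theorem TendstoC2At.comp {l : ℕ → Y → G} {l₀ : Y → G} {φ : ℕ → X → Y} {φ₀ : X → Y} {a : X}
    (hl : TendstoC2At l l₀ (φ₀ a)) (hφ : TendstoC2At φ φ₀ a) :
    TendstoC2At (fun n x => l n (φ n x)) (fun x => l₀ (φ₀ x)) a := by
  have ht : Tendsto (fun q : ℕ × X => (q.1, φ q.1 q.2)) (atTop ×ˢ 𝓝 a)
      (atTop ×ˢ 𝓝 (φ₀ a)) := tendsto_fst.prodMk hφ.tendsto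
  have hc := (ht.eventually hl.contDiffAt).and hφ.contDiffAt
  refine ⟨?_, hl.contDiffAt_limit.comp a hφ.contDiffAt_limit, hl.tendsto.comp ht, ?_, ?_⟩
  · filter_upwards [hc] with q hq using hq.1.comp q.2 hq.2
  · have e : fderiv ℝ (fun x => l₀ (φ₀ x)) a = (fderiv ℝ l₀ (φ₀ a)).comp (fderiv ℝ φ₀ a) :=
      fderiv_comp a (hl.contDiffAt_limit.differentiableAt (by norm_num))
        (hφ.contDiffAt_limit.differentiableAt (by norm_num))
    rw [e]
    refine (tendsto_clm_comp (hl.tendsto_fderiv.comp ht) hφ.tendsto_fderiv).congr' ?_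
    filter_upwards [hc] with q hq
    exact (fderiv_comp q.2 (hq.1.differentiableAt (by norm_num))
      (hq.2.differentiableAt (by norm_num))).symm
  · rw [fderiv_fderiv_comp hl.contDiffAt_limit hφ.contDiffAt_limit]
    have h1 : Tendsto (fun q : ℕ × X => fderiv ℝ (l q.1) (φ q.1 q.2)) (atTop ×ˢ 𝓝 a)
      (𝓝 (fderiv ℝ l₀ (φ₀ a))) := hl.tendsto_fderiv.comp ht
    have h2 : Tendsto (fun q : ℕ × X => fderiv ℝ (fderiv ℝ (l q.1)) (φ q.1 q.2)) (atTop ×ˢ 𝓝 a)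
      (𝓝 (fderiv ℝ (fderiv ℝ l₀) (φ₀ a))) := hl.tendsto_fderiv_fderiv.comp ht
    refine ((tendsto_clm_comp (tendsto_clm_apply tendsto_const_nhds h1)
      hφ.tendsto_fderiv_fderiv).add (tendsto_clm_comp (tendsto_clm_apply tendsto_const_nhds
        hφ.tendsto_fderiv) (tendsto_clm_comp h2 hφ.tendsto_fderiv))).congr' ?_
    filter_upwards [hc] with q hq
    exact (fderiv_fderiv_comp hq.1 hq.2).symm

theorem fderiv_graph {z : X → Y} {x : X} (hz : DifferentiableAt ℝ z x) :
    fderiv ℝ (fun x => (x, z x)) x =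
      ContinuousLinearMap.inl ℝ X Y + (ContinuousLinearMap.inr ℝ X Y).comp (fderiv ℝ z x) := by
  have h : HasFDerivAt (fun x => (x, z x))
      ((ContinuousLinearMap.id ℝ X).prod (fderiv ℝ z x)) x :=
    (hasFDerivAt_id x).prodMk hz.hasFDerivAt
  rw [h.fderiv]
  ext <;> simp

theorem fderiv_fderiv_graph {z : X → Y} {x : X} (hz : ContDiffAt ℝ 2 z x) :
    fderiv ℝ (fderiv ℝ fun x => (x, z x)) x =
      (ContinuousLinearMap.compL ℝ X Y (X × Y) (ContinuousLinearMap.inr ℝ X Y)).comp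
        (fderiv ℝ (fderiv ℝ z) x) := by
  have e : (fderiv ℝ fun x => (x, z x)) =ᶠ[𝓝 x] fun y => ContinuousLinearMap.inl ℝ X Y +
      ContinuousLinearMap.compL ℝ X Y (X × Y) (ContinuousLinearMap.inr ℝ X Y) (fderiv ℝ z y) := by
    filter_upwards [ContDiffAt.eventually_hasFDerivAt hz] with y hy
    exact fderiv_graph hy.differentiableAt
  rw [e.fderiv_eq]
  exact (((ContinuousLinearMap.compL ℝ X Y (X × Y)
    (ContinuousLinearMap.inr ℝ X Y)).hasFDerivAt.comp x
      (ContDiffAt.hasFDerivAt_fderiv hz)).const_add _).fderiv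

theorem TendstoC2At.graph {z : ℕ → X → Y} {z₀ : X → Y} {a : X} (hz : TendstoC2At z z₀ a) :
    TendstoC2At (fun n x => (x, z n x)) (fun x => (x, z₀ x)) a := by
  refine ⟨?_, contDiffAt_id.prodMk hz.contDiffAt_limit, tendsto_snd.prodMk_nhds hz.tendsto, ?_, ?_⟩
  · filter_upwards [hz.contDiffAt] with q hq using contDiffAt_id.prodMk hq
  · rw [fderiv_graph (hz.contDiffAt_limit.differentiableAt (by norm_num))]
    refine (tendsto_const_nhds.add (tendsto_clm_comp tendsto_const_nhds
      hz.tendsto_fderiv)).congr' ?_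
    filter_upwards [hz.contDiffAt] with q hq
    exact (fderiv_graph (hq.differentiableAt (by norm_num))).symm
  · rw [fderiv_fderiv_graph hz.contDiffAt_limit]
    refine (tendsto_clm_comp tendsto_const_nhds hz.tendsto_fderiv_fderiv).congr' ?_
    filter_upwards [hz.contDiffAt] with q hq
    exact (fderiv_fderiv_graph hq).symm

theorem TendstoC2At.profile {l : ℕ → X × Y → ℝ} {l₀ : X × Y → ℝ} {z : ℕ → X → Y} {z₀ : X → Y}
    {a : X} (hl : TendstoC2At l l₀ (a, z₀ a)) (hz : TendstoC2At z z₀ a) :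
    TendstoC2At (fun n => BridgedPosterior.profile (l n) (z n))
      (BridgedPosterior.profile l₀ z₀) a :=
  TendstoC2At.comp (φ₀ := fun x => (x, z₀ x)) hl hz.graph

/-- At a point where `l` is stationary in its second argument, the Hessian of the profiled
function is the restriction of the Hessian of `l` to the tangent space of the graph of `z`. -/
theorem fderiv_fderiv_profile {l : X × Y → ℝ} {z : X → Y} {a : X}
    (hl : ContDiffAt ℝ 2 l (a, z a)) (hz : ContDiffAt ℝ 2 z a)
    (hcrit : HasFDerivAt (fun ζ => l (a, ζ)) (0 : Y →L[ℝ] ℝ) (z a)) (v : X) :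
    fderiv ℝ (fderiv ℝ (profile l z)) a v v =
      fderiv ℝ (fderiv ℝ l) (a, z a) (v, fderiv ℝ z a v) (v, fderiv ℝ z a v) := by
  have h0 : ∀ w : Y, fderiv ℝ l (a, z a) (0, w) = 0 := by
    intro w
    have h1 : HasFDerivAt (fun ζ : Y => (a, ζ)) (ContinuousLinearMap.inr ℝ X Y) (z a) :=
      hasFDerivAt_prodMk_right a (z a)
    have h2 := HasFDerivAt.comp (z a)
      (g := l) (f := fun ζ : Y => (a, ζ)) (hl.differentiableAt (by norm_num)).hasFDerivAt h1
    have h3 := DFunLike.congr_fun (h2.unique hcrit) w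
    simpa using h3
  have hg : ContDiffAt ℝ 2 (fun x => (x, z x)) a := contDiffAt_id.prodMk hz
  have e := fderiv_fderiv_comp (l := l) (φ := fun x => (x, z x)) hl hg
  change fderiv ℝ (fderiv ℝ fun x => l (x, z x)) a v v = _
  rw [e, fderiv_fderiv_graph hz, fderiv_graph (hz.differentiableAt (by norm_num))]
  have hv : (v, fderiv ℝ z a v) = (v, 0) + (0, fderiv ℝ z a v) := by simp
  simp only [add_apply, ContinuousLinearMap.comp_apply, ContinuousLinearMap.compL_apply,
    ContinuousLinearMap.flip_apply, ContinuousLinearMap.inl_apply, ContinuousLinearMap.inr_apply,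
    h0, zero_add, ← hv]

end TendstoC2At

/-! ### Strong concavity near the limiting maximizer -/

section Concave

variable {X : Type*} [NormedAddCommGroup X] [NormedSpace ℝ X]

/-- Second-order Taylor formula with Lagrange remainder. -/
theorem exists_taylor_two {f : X → ℝ} {x y : X} (hf : ∀ w ∈ segment ℝ x y, ContDiffAt ℝ 2 f w) :
    ∃ w ∈ segment ℝ x y, f y = f x + fderiv ℝ f x (y - x)
      + 2⁻¹ * fderiv ℝ (fderiv ℝ f) w (y - x) (y - x) := by
  have hmem : ∀ t ∈ Set.Icc (0 : ℝ) 1, x + t • (y - x) ∈ segment ℝ x y := fun t ht => by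
    rw [segment_eq_image']
    exact ⟨t, ht, rfl⟩
  have hline : ∀ t : ℝ, HasDerivAt (fun t : ℝ => x + t • (y - x)) (y - x) t := fun t => by
    simpa using ((hasDerivAt_id t).smul_const (y - x)).const_add x
  have h1 : ∀ t ∈ Set.Icc (0 : ℝ) 1, HasDerivAt (fun t : ℝ => f (x + t • (y - x)))
      (fderiv ℝ f (x + t • (y - x)) (y - x)) t := fun t ht =>
    ((hf _ (hmem t ht)).differentiableAt (by norm_num)).hasFDerivAt.comp_hasDerivAt t (hline t)
  have h2 : ∀ t ∈ Set.Icc (0 : ℝ) 1, HasDerivAt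
      (fun t : ℝ => fderiv ℝ f (x + t • (y - x)) (y - x))
      (fderiv ℝ (fderiv ℝ f) (x + t • (y - x)) (y - x) (y - x)) t := fun t ht => by
    have h3 : HasDerivAt (fun t : ℝ => fderiv ℝ f (x + t • (y - x)))
        (fderiv ℝ (fderiv ℝ f) (x + t • (y - x)) (y - x)) t :=
      (ContDiffAt.hasFDerivAt_fderiv (hf _ (hmem t ht))).comp_hasDerivAt t (hline t)
    exact (ContinuousLinearMap.apply ℝ ℝ (y - x)).hasFDerivAt.comp_hasDerivAt t h3
  -- Rolle's theorem for `ψ t = f (γ t) + (1 - t) f' (γ t) (y - x) + C (1 - t)²`, where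
  -- `γ t = x + t (y - x)` and `C` is chosen such that `ψ 0 = ψ 1`.
  set C : ℝ := f y - f x - fderiv ℝ f x (y - x) with hC
  have hψ : ∀ t ∈ Set.Icc (0 : ℝ) 1, HasDerivAt
      (fun t : ℝ => f (x + t • (y - x)) + (1 - t) * fderiv ℝ f (x + t • (y - x)) (y - x)
        + C * (1 - t) ^ 2)
      ((1 - t) * (fderiv ℝ (fderiv ℝ f) (x + t • (y - x)) (y - x) (y - x) - 2 * C)) t := by
    intro t ht
    have h3 : HasDerivAt (fun t : ℝ => 1 - t) (-1) t := by
      simpa using (hasDerivAt_id t).const_sub 1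
    refine (((h1 t ht).add (h3.mul (h2 t ht))).add ((h3.pow 2).const_mul C)).congr_deriv ?_
    simp
    ring
  obtain ⟨t, ht, h0⟩ := exists_hasDerivAt_eq_zero (zero_lt_one' ℝ)
    (fun t ht => (hψ t ht).continuousAt.continuousWithinAt) (by simp [hC])
    (fun t ht => hψ t (Set.Ioo_subset_Icc_self ht))
  refine ⟨_, hmem t (Set.Ioo_subset_Icc_self ht), ?_⟩
  have h4 := (mul_eq_zero.1 h0).resolve_left (by linarith [ht.2])
  linarith

/-- A negative definite form on a finite-dimensional space is bounded away from `0` on the unit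
sphere, by compactness. -/
theorem exists_pos_forall_le_neg_mul_norm_sq [FiniteDimensional ℝ X] {B : X →L[ℝ] X →L[ℝ] ℝ}
    (hB : ∀ v, v ≠ 0 → B v v < 0) : ∃ c > 0, ∀ v, B v v ≤ -c * ‖v‖ ^ 2 := by
  rcases (Metric.sphere (0 : X) 1).eq_empty_or_nonempty with he | hne
  · refine ⟨1, one_pos, fun v => ?_⟩
    have hv : v = 0 := by
      by_contra hv
      have : ‖v‖⁻¹ • v ∈ Metric.sphere (0 : X) 1 := by simp [norm_smul, hv]
      simp [he] at this
    simp [hv]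
  · obtain ⟨v₀, hv₀, hmax⟩ := (isCompact_sphere (0 : X) 1).exists_isMaxOn hne
      (f := fun v => B v v) (by fun_prop)
    have hv₀' : v₀ ≠ 0 := by
      rintro rfl
      simp at hv₀
    refine ⟨-B v₀ v₀, by linarith [hB v₀ hv₀'], fun v => ?_⟩
    rcases eq_or_ne v 0 with rfl | hv
    · simp
    · have h1 : B (‖v‖⁻¹ • v) (‖v‖⁻¹ • v) ≤ B v₀ v₀ := hmax (by simp [norm_smul, hv])
      have h2 : 0 < ‖v‖ := norm_pos_iff.2 hv
      simp only [map_smul, smul_apply, smul_eq_mul] at h1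
      have h3 : B v v = ‖v‖ ^ 2 * (‖v‖⁻¹ * (‖v‖⁻¹ * B v v)) := by field_simp
      rw [h3, neg_neg, mul_comm]
      gcongr

theorem eventually_forall_mem_ball {X : Type*} [PseudoMetricSpace X] {p : ℕ → X → Prop} {a : X}
    (h : ∀ᶠ q : ℕ × X in atTop ×ˢ 𝓝 a, p q.1 q.2) :
    ∃ r > 0, ∀ᶠ n in atTop, ∀ x ∈ Metric.ball a r, p n x := by
  obtain ⟨pa, ha, pb, hb, hab⟩ := eventually_prod_iff.1 h
  obtain ⟨r, hr, hrb⟩ := Metric.eventually_nhds_iff_ball.1 hb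
  exact ⟨r, hr, ha.mono fun n hn x hx => hab hn (hrb x hx)⟩

theorem le_of_concave {f : X → ℝ} {a : X} {c r : ℝ}
    (hf : ∀ x ∈ Metric.ball a r, ContDiffAt ℝ 2 f x ∧
      ∀ v, fderiv ℝ (fderiv ℝ f) x v v ≤ -c * ‖v‖ ^ 2) {x y : X} (hx : x ∈ Metric.ball a r)
    (hy : y ∈ Metric.ball a r) :
    f y ≤ f x + fderiv ℝ f x (y - x) - c / 2 * ‖y - x‖ ^ 2 := by
  have hs := (convex_ball a r).segment_subset hx hy
  obtain ⟨w, hw, e⟩ := exists_taylor_two fun w hw => (hf w (hs hw)).1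
  linarith [(hf w (hs hw)).2 (y - x)]

variable [FiniteDimensional ℝ X] {f : ℕ → X → ℝ} {g : X → ℝ} {a : X}

theorem TendstoC2At.exists_forall_concave (h : TendstoC2At f g a)
    (hneg : ∀ v, v ≠ 0 → fderiv ℝ (fderiv ℝ g) a v v < 0) :
    ∃ c > 0, ∃ r > 0, (∀ v, fderiv ℝ (fderiv ℝ g) a v v ≤ -c * ‖v‖ ^ 2) ∧
      ∀ᶠ n in atTop, ∀ x ∈ Metric.ball a r, ContDiffAt ℝ 2 (f n) x ∧
        ∀ v, fderiv ℝ (fderiv ℝ (f n)) x v v ≤ -c * ‖v‖ ^ 2 := by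
  obtain ⟨c, hc, hcv⟩ := exists_pos_forall_le_neg_mul_norm_sq hneg
  have h1 := h.tendsto_fderiv_fderiv.eventually_mem
    (Metric.ball_mem_nhds (fderiv ℝ (fderiv ℝ g) a) (half_pos hc))
  obtain ⟨r, hr, hev⟩ := eventually_forall_mem_ball
    (p := fun n x => ContDiffAt ℝ 2 (f n) x ∧
      fderiv ℝ (fderiv ℝ (f n)) x ∈ Metric.ball (fderiv ℝ (fderiv ℝ g) a) (c / 2))
    (h.contDiffAt.and h1)
  -- Half of the coercivity constant of `g''` is given up to absorb `‖(f n)'' x - g''(a)‖ < c / 2`.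
  refine ⟨c / 2, half_pos hc, r, hr, fun v => (hcv v).trans ?_, hev.mono fun n hn x hx =>
    ⟨(hn x hx).1, fun v => ?_⟩⟩
  · nlinarith [sq_nonneg ‖v‖]
  · have h2 : ‖fderiv ℝ (fderiv ℝ (f n)) x - fderiv ℝ (fderiv ℝ g) a‖ < c / 2 :=
      (mem_ball_iff_norm (E := X →L[ℝ] X →L[ℝ] ℝ)).1 (hn x hx).2
    have h3 := (fderiv ℝ (fderiv ℝ (f n)) x - fderiv ℝ (fderiv ℝ g) a).le_opNorm₂ v v
    have h4 : ‖fderiv ℝ (fderiv ℝ (f n)) x - fderiv ℝ (fderiv ℝ g) a‖ * ‖v‖ * ‖v‖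
        ≤ c / 2 * ‖v‖ * ‖v‖ := by gcongr
    have h5 := (Real.le_norm_self _).trans (h3.trans h4)
    simp only [sub_apply] at h5
    nlinarith [hcv v]

/-- If the limit `g` has a nondegenerate critical maximum at `a`, then the `f n` have critical
points converging to `a`: their maximizers on a small closed ball. -/
theorem TendstoC2At.exists_critical_points (h : TendstoC2At f g a)
    (hneg : ∀ v, v ≠ 0 → fderiv ℝ (fderiv ℝ g) a v v < 0) (hg : fderiv ℝ g a = 0) :
    ∃ m : ℕ → X, Tendsto m atTop (𝓝 a) ∧
      ∀ᶠ n in atTop, HasFDerivAt (f n) (0 : X →L[ℝ] ℝ) (m n) := by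
  obtain ⟨c, hc, r, hr, -, hev⟩ := h.exists_forall_concave hneg
  have hsub : Metric.closedBall a (r / 2) ⊆ Metric.ball a r :=
    Metric.closedBall_subset_ball (by linarith)
  obtain ⟨m, hm⟩ : ∃ m : ℕ → X, ∀ᶠ n in atTop,
      m n ∈ Metric.closedBall a (r / 2) ∧ IsMaxOn (f n) (Metric.closedBall a (r / 2)) (m n) := by
    refine Filter.Eventually.choice (r := fun n x => x ∈ Metric.closedBall a (r / 2) ∧
      IsMaxOn (f n) (Metric.closedBall a (r / 2)) x) (hev.mono fun n hn => ?_)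
    refine (isCompact_closedBall a (r / 2)).exists_isMaxOn ⟨a, by simp; linarith⟩ fun x hx => ?_
    exact (hn x (hsub hx)).1.continuousAt.continuousWithinAt
  have hd : Tendsto (fun n => fderiv ℝ (f n) a) atTop (𝓝 0) := by
    rw [← hg]
    exact h.tendsto_fderiv.comp (tendsto_id.prodMk tendsto_const_nhds)
  have hlim : Tendsto m atTop (𝓝 a) := by
    rw [tendsto_iff_norm_sub_tendsto_zero]
    have h0 : Tendsto (fun n => 2 / c * ‖fderiv ℝ (f n) a‖) atTop (𝓝 0) := by
      simpa using (tendsto_norm_zero.comp hd).const_mul (2 / c)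
    refine squeeze_zero' (.of_forall fun _ => norm_nonneg _) ?_ h0
    filter_upwards [hev, hm] with n hn hmn
    have h1 := le_of_concave hn (Metric.mem_ball_self hr) (hsub hmn.1)
    have h2 : f n a ≤ f n (m n) := hmn.2 (Metric.mem_closedBall_self (by linarith))
    have h3 := (Real.le_norm_self _).trans ((fderiv ℝ (f n) a).le_opNorm (m n - a))
    rcases (norm_nonneg (m n - a)).eq_or_lt with h4 | h4
    · rw [← h4]
      positivity
    · have h5 : c / 2 * ‖m n - a‖ * ‖m n - a‖ ≤ ‖fderiv ℝ (f n) a‖ * ‖m n - a‖ := by nlinarith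
      have h6 := le_of_mul_le_mul_right h5 h4
      rw [div_mul_eq_mul_div, le_div_iff₀ hc]
      linarith
  refine ⟨m, hlim, ?_⟩
  filter_upwards [hev, hm, hlim.eventually (Metric.ball_mem_nhds a (half_pos hr))] with n hn hmn hb
  have hloc : IsLocalMax (f n) (m n) :=
    hmn.2.isLocalMax (Filter.mem_of_superset (Metric.isOpen_ball.mem_nhds hb)
      Metric.ball_subset_closedBall)
  have := ((hn _ (hsub hmn.1)).1.differentiableAt (by norm_num)).hasFDerivAt
  rwa [hloc.fderiv_eq_zero] at this

theorem eventually_forall_mem_compact_lt {X : Type*} [PseudoMetricSpace X] {f : ℕ → X → ℝ}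
    {g : X → ℝ} {K : Set X} (hK : IsCompact K) {v : ℝ}
    (hf : ∀ x ∈ K, Tendsto (fun q : ℕ × X => f q.1 q.2) (atTop ×ˢ 𝓝 x) (𝓝 (g x)))
    (hg : ∀ x ∈ K, g x < v) : ∃ η > 0, ∀ᶠ n in atTop, ∀ x ∈ K, f n x < v - η := by
  refine hK.induction_on (p := fun s => ∃ η > 0, ∀ᶠ n in atTop, ∀ x ∈ s, f n x < v - η)
    ⟨1, one_pos, by simp⟩ ?_ ?_ ?_
  · rintro s t hst ⟨η, hη, h⟩
    exact ⟨η, hη, h.mono fun n hn x hx => hn x (hst hx)⟩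
  · rintro s t ⟨η, hη, h⟩ ⟨η', hη', h'⟩
    refine ⟨min η η', lt_min hη hη', ?_⟩
    filter_upwards [h, h'] with n hn hn' x hx
    rcases hx with hx | hx
    · linarith [hn x hx, min_le_left η η']
    · linarith [hn' x hx, min_le_right η η']
  · intro x hx
    have h1 : g x < v - (v - g x) / 2 := by linarith [hg x hx]
    obtain ⟨r, hr, h⟩ := eventually_forall_mem_ball
      (p := fun n y => f n y < v - (v - g x) / 2) ((hf x hx).eventually_lt_const h1)
    exact ⟨Metric.ball x r, mem_nhdsWithin_of_mem_nhds (Metric.ball_mem_nhds x hr),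
      (v - g x) / 2, by linarith [hg x hx], h⟩

end Concave

/-! ### Laplace asymptotics -/

section Laplace

variable {d : ℕ}

theorem integrable_exp_neg_mul_norm_sq {b : ℝ} (hb : 0 < b) :
    Integrable fun u : EuclideanSpace ℝ (Fin d) => Real.exp (-b * ‖u‖ ^ 2) := by
  have h := (GaussianFourier.integrable_cexp_neg_mul_sq_norm_add (V := EuclideanSpace ℝ (Fin d))
    (b := (b : ℂ)) (by simpa using hb) 0 0).norm
  refine h.congr (.of_forall fun u => ?_)
  simp [Complex.norm_exp, ← Complex.ofReal_pow]

theorem quasiMeasurePreserving_add_smul (c : EuclideanSpace ℝ (Fin d)) {r : ℝ} (hr : r ≠ 0) :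
    Measure.QuasiMeasurePreserving (fun u : EuclideanSpace ℝ (Fin d) => c + r • u) :=
  (measurePreserving_add_left volume c).quasiMeasurePreserving.comp
    (Measure.quasiMeasurePreserving_smul volume hr)

theorem integrable_comp_add_smul {G : EuclideanSpace ℝ (Fin d) → ℝ} (hG : Integrable G)
    (c : EuclideanSpace ℝ (Fin d)) {r : ℝ} (hr : r ≠ 0) : Integrable fun u => G (c + r • u) :=
  (hG.comp_add_left c).comp_smul hr

theorem integral_comp_add_inv_smul (G : EuclideanSpace ℝ (Fin d) → ℝ)
    (c : EuclideanSpace ℝ (Fin d)) {r : ℝ} (hr : 0 ≤ r) :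
    ∫ u, G (c + r⁻¹ • u) = r ^ d * ∫ x, G x := by
  have := Measure.integral_comp_inv_smul_of_nonneg volume (fun x => G (c + x)) hr
  rw [this, integral_add_left_eq_self, finrank_euclideanSpace_fin, smul_eq_mul]

/-- The unnormalized density of `√n (λ - c)` when `λ` has density proportional to
`exp (n F) * prior` on `Θ`; the normalization is chosen such that the exponential is `1` at `c`. -/
noncomputable def rescaledDensity (Θ : Set (EuclideanSpace ℝ (Fin d)))
    (prior F : EuclideanSpace ℝ (Fin d) → ℝ)
    (c : EuclideanSpace ℝ (Fin d)) (n : ℕ) (u : EuclideanSpace ℝ (Fin d)) : ℝ :=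
  Θ.indicator (fun x => Real.exp (n * (F x - F c)) * prior x) (c + (Real.sqrt n)⁻¹ • u)

/-- The unnormalized Gaussian density `κ exp (B(u, u) / 2)`. -/
noncomputable def quadDensity (κ : ℝ)
    (B : EuclideanSpace ℝ (Fin d) →L[ℝ] EuclideanSpace ℝ (Fin d) →L[ℝ] ℝ)
    (u : EuclideanSpace ℝ (Fin d)) : ℝ :=
  κ * Real.exp (2⁻¹ * B u u)

variable {f : ℕ → EuclideanSpace ℝ (Fin d) → ℝ} {g : EuclideanSpace ℝ (Fin d) → ℝ}
  {a : EuclideanSpace ℝ (Fin d)} {m : ℕ → EuclideanSpace ℝ (Fin d)}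
  {Θ : Set (EuclideanSpace ℝ (Fin d))} {prior : EuclideanSpace ℝ (Fin d) → ℝ}

theorem tendsto_add_inv_sqrt_smul (hm : Tendsto m atTop (𝓝 a)) (u : EuclideanSpace ℝ (Fin d)) :
    Tendsto (fun n : ℕ => m n + (Real.sqrt n)⁻¹ • u) atTop (𝓝 a) := by
  have h1 : Tendsto (fun n : ℕ => (Real.sqrt n)⁻¹) atTop (𝓝 0) :=
    tendsto_inv_atTop_zero.comp (Real.tendsto_sqrt_atTop.comp tendsto_natCast_atTop_atTop)
  simpa using hm.add (h1.smul_const u)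

/-- Taylor's formula at the critical point `m n`: the remainder is evaluated at points `w n` of the
segment from `m n` to `m n + u / √n`, which converge to `a`. -/
theorem tendsto_rescaledDensity (h : TendstoC2At f g a) (hm : Tendsto m atTop (𝓝 a))
    (hcrit : ∀ᶠ n in atTop, HasFDerivAt (f n) (0 : EuclideanSpace ℝ (Fin d) →L[ℝ] ℝ) (m n))
    (hΘ : Θ ∈ 𝓝 a) (hprior : ContinuousAt prior a) (u : EuclideanSpace ℝ (Fin d)) :
    Tendsto (fun n => rescaledDensity Θ prior (f n) (m n) n u) atTop
      (𝓝 (quadDensity (prior a) (fderiv ℝ (fderiv ℝ g) a) u)) := by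
  set x : ℕ → EuclideanSpace ℝ (Fin d) := fun n => m n + (Real.sqrt n)⁻¹ • u with hx
  have hxa : Tendsto x atTop (𝓝 a) := tendsto_add_inv_sqrt_smul hm u
  obtain ⟨r, hr, hC2⟩ := eventually_forall_mem_ball (p := fun n x => ContDiffAt ℝ 2 (f n) x)
    h.contDiffAt
  have hseg : ∀ ρ > 0, ∀ᶠ n in atTop, segment ℝ (m n) (x n) ⊆ Metric.ball a ρ := fun ρ hρ => by
    filter_upwards [hm.eventually_mem (Metric.ball_mem_nhds a hρ),
      hxa.eventually_mem (Metric.ball_mem_nhds a hρ)] with n h1 h2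
    exact (convex_ball a ρ).segment_subset h1 h2
  obtain ⟨w, hw⟩ : ∃ w : ℕ → EuclideanSpace ℝ (Fin d), ∀ᶠ n in atTop,
      w n ∈ segment ℝ (m n) (x n) ∧ f n (x n) = f n (m n) + fderiv ℝ (f n) (m n) (x n - m n)
      + 2⁻¹ * fderiv ℝ (fderiv ℝ (f n)) (w n) (x n - m n) (x n - m n) := by
    refine Filter.Eventually.choice (r := fun n w => w ∈ segment ℝ (m n) (x n) ∧
      f n (x n) = f n (m n) + fderiv ℝ (f n) (m n) (x n - m n)
      + 2⁻¹ * fderiv ℝ (fderiv ℝ (f n)) w (x n - m n) (x n - m n)) ?_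
    filter_upwards [hC2, hseg r hr] with n h1 h2
    exact exists_taylor_two fun y hy => h1 y (h2 hy)
  have hwa : Tendsto w atTop (𝓝 a) := by
    refine Metric.tendsto_nhds.2 fun ρ hρ => ?_
    filter_upwards [hw, hseg ρ hρ] with n h1 h2 using h2 h1.1
  have hB : Tendsto (fun n => 2⁻¹ * fderiv ℝ (fderiv ℝ (f n)) (w n) u u) atTop
      (𝓝 (2⁻¹ * fderiv ℝ (fderiv ℝ g) a u u)) :=
    (tendsto_clm_apply (tendsto_clm_apply
      (h.tendsto_fderiv_fderiv.comp (tendsto_id.prodMk hwa)) tendsto_const_nhds)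
      tendsto_const_nhds).const_mul _
  have hlim := (hprior.tendsto.comp hxa).mul ((Real.continuous_exp.tendsto _).comp hB)
  refine hlim.congr' ?_
  filter_upwards [hw, hcrit, hxa.eventually_mem hΘ, eventually_gt_atTop 0] with n h1 h2 h3 h4
  have hn : (0 : ℝ) < n := by exact_mod_cast h4
  have hxm : x n - m n = (Real.sqrt n)⁻¹ • u := by simp [hx]
  have e := h1.2
  rw [h2.fderiv, hxm] at e
  simp only [zero_apply, map_smul, smul_apply, smul_eq_mul, mul_zero, add_zero] at e
  rw [rescaledDensity, Set.indicator_of_mem h3]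
  change _ = Real.exp (n * (f n (x n) - f n (m n))) * prior (x n)
  rw [e, mul_comm]
  simp only [Function.comp_apply]
  congr 2
  have hs : (Real.sqrt n)⁻¹ * (Real.sqrt n)⁻¹ = (n : ℝ)⁻¹ := by
    rw [← mul_inv, Real.mul_self_sqrt hn.le]
  rw [add_sub_cancel_left, ← mul_assoc (Real.sqrt n)⁻¹, hs]
  field_simp

/-- Near the critical points, strong concavity dominates the rescaled densities by one Gaussian. -/
theorem rescaledDensity_le {F : EuclideanSpace ℝ (Fin d) → ℝ} {c r κ : ℝ}
    (hF : ∀ x ∈ Metric.ball a r, ContDiffAt ℝ 2 F x ∧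
      ∀ v, fderiv ℝ (fderiv ℝ F) x v v ≤ -c * ‖v‖ ^ 2)
    {b : EuclideanSpace ℝ (Fin d)} (hb : b ∈ Metric.ball a r)
    (hcrit : HasFDerivAt F (0 : EuclideanSpace ℝ (Fin d) →L[ℝ] ℝ) b) {n : ℕ} (hn : n ≠ 0)
    {u : EuclideanSpace ℝ (Fin d)} (hu : b + (Real.sqrt n)⁻¹ • u ∈ Metric.ball a r)
    (hκ : 0 ≤ κ) (hprior : prior (b + (Real.sqrt n)⁻¹ • u) ≤ κ) :
    rescaledDensity Θ prior F b n u ≤ κ * Real.exp (-(c / 2) * ‖u‖ ^ 2) := by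
  refine Set.indicator_apply_le' (fun _ => ?_) fun _ => by positivity
  have hn0 : (0 : ℝ) < n := by positivity
  have h1 := le_of_concave hF hb hu
  rw [hcrit.fderiv, zero_apply, add_sub_cancel_left, norm_smul, mul_pow, norm_inv, inv_pow,
    Real.norm_of_nonneg (Real.sqrt_nonneg _), Real.sq_sqrt hn0.le] at h1
  have h2 : n * (F (b + (Real.sqrt n)⁻¹ • u) - F b) ≤ -(c / 2) * ‖u‖ ^ 2 := by
    calc _ ≤ n * (-(c / 2 * ((n : ℝ)⁻¹ * ‖u‖ ^ 2))) := by gcongr; linarith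
      _ = _ := by field_simp
  rw [mul_comm]
  exact mul_le_mul hprior (Real.exp_le_exp.2 h2) (Real.exp_pos _).le hκ

theorem rescaledDensity_nonneg (hprior : ∀ x ∈ Θ, 0 ≤ prior x) (F : EuclideanSpace ℝ (Fin d) → ℝ)
    (c : EuclideanSpace ℝ (Fin d)) (n : ℕ) (u : EuclideanSpace ℝ (Fin d)) :
    0 ≤ rescaledDensity Θ prior F c n u :=
  Set.indicator_apply_nonneg fun h => mul_nonneg (Real.exp_pos _).le (hprior _ h)

theorem aestronglyMeasurable_rescaledDensity (hΘ : MeasurableSet Θ)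
    (hprior : AEStronglyMeasurable prior (volume.restrict Θ)) {F : EuclideanSpace ℝ (Fin d) → ℝ}
    (hF : AEMeasurable F (volume.restrict Θ)) (c : EuclideanSpace ℝ (Fin d)) {n : ℕ}
    (hn : n ≠ 0) : AEStronglyMeasurable (rescaledDensity Θ prior F c n) := by
  have h1 : AEStronglyMeasurable
      (Θ.indicator fun x => Real.exp (n * (F x - F c)) * prior x) :=
    (aestronglyMeasurable_indicator_iff hΘ).2
      ((Real.measurable_exp.comp_aemeasurable
        ((hF.sub_const _).const_mul _)).aestronglyMeasurable.mul hprior)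
  exact h1.comp_quasiMeasurePreserving (quasiMeasurePreserving_add_smul c (by positivity))

theorem integrable_quadDensity
    {B : EuclideanSpace ℝ (Fin d) →L[ℝ] EuclideanSpace ℝ (Fin d) →L[ℝ] ℝ}
    (hB : ∀ v, v ≠ 0 → B v v < 0) (κ : ℝ) : Integrable (quadDensity κ B) := by
  obtain ⟨c, hc, h⟩ := exists_pos_forall_le_neg_mul_norm_sq hB
  refine Integrable.const_mul ?_ κ
  refine (integrable_exp_neg_mul_norm_sq (half_pos hc)).mono' ?_ (.of_forall fun u => ?_)
  · exact Continuous.aestronglyMeasurable (by fun_prop)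
  · rw [Real.norm_of_nonneg (Real.exp_pos _).le]
    exact Real.exp_le_exp.2 (by linarith [h u])

/-- The mass which the rescaled densities put away from the critical points is at most of this form,
with `C` the mass of the prior: `√n ^ d` is the Jacobian of the rescaling. -/
theorem tendsto_sqrt_pow_mul_exp_neg (d : ℕ) {η : ℝ} (hη : 0 < η) (C : ℝ) :
    Tendsto (fun n : ℕ => Real.exp (-(n * η)) * (Real.sqrt n ^ d * C)) atTop (𝓝 0) := by
  have h1 : Tendsto (fun n : ℕ => (n : ℝ) ^ d * Real.exp (-η) ^ n) atTop (𝓝 0) :=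
    tendsto_pow_const_mul_const_pow_of_abs_lt_one d (by
      rw [abs_of_pos (Real.exp_pos _)]
      simpa using hη)
  have h2 : Tendsto (fun n : ℕ => Real.sqrt n ^ d * Real.exp (-η) ^ n) atTop (𝓝 0) := by
    refine squeeze_zero (fun n => by positivity) (fun n => ?_) h1
    gcongr
    rcases Nat.eq_zero_or_pos n with rfl | hn
    · simp
    · have : (1 : ℝ) ≤ n := by exact_mod_cast hn
      rw [Real.sqrt_le_left (by positivity)]
      nlinarith
  have h3 := h2.mul_const C
  rw [zero_mul] at h3
  refine h3.congr fun n => ?_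
  rw [← Real.exp_nat_mul]
  ring_nf

/-- Laplace's method: the rescaled densities converge in `L¹` to the Gaussian density given by the
Hessian of the limit. -/
theorem tendsto_integral_abs_rescaledDensity_sub (h : TendstoC2At f g a)
    (hneg : ∀ v, v ≠ 0 → fderiv ℝ (fderiv ℝ g) a v v < 0) (hm : Tendsto m atTop (𝓝 a))
    (hcrit : ∀ᶠ n in atTop, HasFDerivAt (f n) (0 : EuclideanSpace ℝ (Fin d) →L[ℝ] ℝ) (m n))
    (hΘm : MeasurableSet Θ) (hΘ : Θ ∈ 𝓝 a) (hprior : ContinuousAt prior a)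
    (hprior_nonneg : ∀ x ∈ Θ, 0 ≤ prior x) (hprior_int : IntegrableOn prior Θ)
    (hf : ∀ᶠ n in atTop, AEMeasurable (f n) (volume.restrict Θ))
    (hout : ∀ r > 0, ∃ η > 0, ∀ᶠ n in atTop, ∀ x ∈ Θ \ Metric.ball a r, f n x ≤ f n (m n) - η) :
    (∀ᶠ n in atTop, Integrable (rescaledDensity Θ prior (f n) (m n) n)) ∧
    Tendsto (fun n => ∫ u, |rescaledDensity Θ prior (f n) (m n) n u -
      quadDensity (prior a) (fderiv ℝ (fderiv ℝ g) a) u|) atTop (𝓝 0) := by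
  obtain ⟨c, hc, r₁, hr₁, hgc, hconc⟩ := h.exists_forall_concave hneg
  set κ := prior a + 1 with hκ
  have hκ0 : 0 < κ := by have := hprior_nonneg a (mem_of_mem_nhds hΘ); linarith
  obtain ⟨r₂, hr₂, hball⟩ := Metric.eventually_nhds_iff_ball.1
    (hprior.eventually_le_const (lt_add_one (prior a)))
  set r := min r₁ r₂ with hr_def
  have hr : 0 < r := lt_min hr₁ hr₂
  obtain ⟨η, hη, hfar⟩ := hout r hr
  set H : ℕ → EuclideanSpace ℝ (Fin d) → ℝ := fun n => rescaledDensity Θ prior (f n) (m n) n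
  set q := quadDensity (prior a) (fderiv ℝ (fderiv ℝ g) a) with hq
  set T : ℕ → Set (EuclideanSpace ℝ (Fin d)) :=
    fun n => (fun u => m n + (Real.sqrt n)⁻¹ • u) ⁻¹' Metric.ball a r with hT
  have hTm : ∀ n, MeasurableSet (T n) := fun n =>
    Metric.isOpen_ball.measurableSet.preimage (by fun_prop)
  set D : EuclideanSpace ℝ (Fin d) → ℝ := fun u => κ * Real.exp (-(c / 2) * ‖u‖ ^ 2) with hD
  have hDint : Integrable D := (integrable_exp_neg_mul_norm_sq (half_pos hc)).const_mul κ
  have hq_le : ∀ u, |q u| ≤ D u := fun u => by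
    have h0 := hprior_nonneg a (mem_of_mem_nhds hΘ)
    rw [hq, quadDensity, abs_of_nonneg (by positivity)]
    refine mul_le_mul (by linarith) (Real.exp_le_exp.2 ?_) (Real.exp_pos _).le hκ0.le
    linarith [hgc u]
  have hqint : Integrable q := integrable_quadDensity hneg _
  have hHm : ∀ᶠ n in atTop, AEStronglyMeasurable (H n) := by
    filter_upwards [hf, eventually_ne_atTop 0] with n hn hn0
    exact aestronglyMeasurable_rescaledDensity hΘm hprior_int.aestronglyMeasurable hn _ hn0
  -- the part close to the critical point
  have hnear : ∀ᶠ n in atTop, ∀ u, |(T n).indicator (H n) u| ≤ D u := by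
    filter_upwards [hconc, hcrit, hm.eventually_mem (Metric.ball_mem_nhds a hr₁),
      eventually_ne_atTop 0] with n h1 h2 h3 h4 u
    by_cases hu : u ∈ T n
    · rw [Set.indicator_of_mem hu, abs_of_nonneg (rescaledDensity_nonneg hprior_nonneg _ _ _ _)]
      exact rescaledDensity_le h1 h3 h2 h4 (Metric.ball_subset_ball (min_le_left _ _) hu) hκ0.le
        (hball _ (Metric.ball_subset_ball (min_le_right _ _) hu))
    · rw [Set.indicator_of_notMem hu, abs_zero]
      positivity
  have hnear_lim : Tendsto (fun n => ∫ u, |(T n).indicator (H n) u - q u|) atTop (𝓝 0) := by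
    rw [← integral_zero (EuclideanSpace ℝ (Fin d)) ℝ]
    refine tendsto_integral_filter_of_dominated_convergence (fun u => D u + D u) ?_ ?_
      (hDint.add hDint) (.of_forall fun u => ?_)
    · filter_upwards [hHm] with n hn
      exact ((hn.indicator (hTm n)).sub hqint.aestronglyMeasurable).norm
    · filter_upwards [hnear] with n hn
      refine .of_forall fun u => ?_
      rw [Real.norm_eq_abs, abs_abs]
      exact (abs_sub _ _).trans (add_le_add (hn u) (hq_le u))
    · have h1 : Tendsto (fun n => H n u) atTop (𝓝 (q u)) :=
        tendsto_rescaledDensity h hm hcrit hΘ hprior u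
      have h2 : Tendsto (fun n => |H n u - q u|) atTop (𝓝 0) := by
        simpa using (h1.sub_const (q u)).abs
      refine h2.congr' ?_
      filter_upwards [(tendsto_add_inv_sqrt_smul hm u).eventually_mem
        (Metric.ball_mem_nhds a hr)] with n hn
      rw [Set.indicator_of_mem (show u ∈ T n from hn)]
  -- the part far from the critical point
  set G : ℕ → EuclideanSpace ℝ (Fin d) → ℝ := fun n u =>
    Real.exp (-(n * η)) * Θ.indicator prior (m n + (Real.sqrt n)⁻¹ • u) with hG
  have hGint : ∀ n : ℕ, n ≠ 0 → Integrable (G n) := fun n hn =>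
    (integrable_comp_add_smul ((integrable_indicator_iff hΘm).2 hprior_int) (m n)
      (by positivity)).const_mul _
  have hfar' : ∀ᶠ n in atTop, ∀ u, |H n u - (T n).indicator (H n) u| ≤ G n u := by
    filter_upwards [hfar] with n hn u
    have hG0 : 0 ≤ G n u := mul_nonneg (Real.exp_pos _).le
      (Set.indicator_apply_nonneg fun h => hprior_nonneg _ h)
    by_cases hu : u ∈ T n
    · rwa [Set.indicator_of_mem hu, sub_self, abs_zero]
    · rw [Set.indicator_of_notMem hu, sub_zero,
        abs_of_nonneg (rescaledDensity_nonneg hprior_nonneg _ _ _ _)]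
      by_cases hx : m n + (Real.sqrt n)⁻¹ • u ∈ Θ
      · simp only [hG, rescaledDensity, Set.indicator_of_mem hx]
        refine mul_le_mul_of_nonneg_right (Real.exp_le_exp.2 ?_) (hprior_nonneg _ hx)
        rw [← mul_neg]
        exact mul_le_mul_of_nonneg_left (by linarith [hn _ ⟨hx, hu⟩]) (Nat.cast_nonneg n)
      · simpa only [H, rescaledDensity, Set.indicator_of_notMem hx] using hG0
  have hGlim : Tendsto (fun n => ∫ u, G n u) atTop (𝓝 0) := by
    refine (tendsto_sqrt_pow_mul_exp_neg d hη (∫ x, Θ.indicator prior x)).congr fun n => ?_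
    rw [hG, integral_const_mul, integral_comp_add_inv_smul _ _ (Real.sqrt_nonneg _)]
  have hHint : ∀ᶠ n in atTop, Integrable (H n) := by
    filter_upwards [hHm, hnear, hfar', eventually_ne_atTop 0] with n h1 h2 h3 h4
    refine (hDint.add (hGint n h4)).mono' h1 (.of_forall fun u => ?_)
    have := abs_add_le ((T n).indicator (H n) u) (H n u - (T n).indicator (H n) u)
    rw [add_sub_cancel] at this
    exact this.trans (add_le_add (h2 u) (h3 u))
  refine ⟨hHint, ?_⟩
  have hsum : Tendsto (fun n => (∫ u, |(T n).indicator (H n) u - q u|) + ∫ u, G n u) atTop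
      (𝓝 0) := by simpa using hnear_lim.add hGlim
  refine squeeze_zero' (.of_forall fun n => integral_nonneg fun u => abs_nonneg _) ?_ hsum
  filter_upwards [hHint, hfar', eventually_ne_atTop 0] with n h1 h2 h3
  have h4 : Integrable fun u => |(T n).indicator (H n) u - q u| :=
    ((h1.indicator (hTm n)).sub hqint).abs
  rw [← integral_add h4 (hGint n h3)]
  refine integral_mono (h1.sub hqint).abs (h4.add (hGint n h3)) fun u => ?_
  have := abs_add_le ((T n).indicator (H n) u - q u) (H n u - (T n).indicator (H n) u)
  rw [show (T n).indicator (H n) u - q u + (H n u - (T n).indicator (H n) u) = H n u - q u by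
    ring] at this
  exact this.trans (add_le_add le_rfl (h2 u))

end Laplace

/-! ### Measures with a density up to normalization -/

section Densities

theorem map_withDensity_measurableEquiv {X Y : Type*} [MeasurableSpace X] [MeasurableSpace Y]
    (μ : Measure X) (f : X → ENNReal) (e : X ≃ᵐ Y) :
    (μ.withDensity f).map e = (μ.map e).withDensity (f ∘ e.symm) := by
  ext s hs
  rw [e.map_apply, withDensity_apply _ (e.measurable hs), withDensity_apply _ hs, e.restrict_map,
    lintegral_map_equiv]
  simp

variable {X : Type*} [MeasurableSpace X] {μ : Measure X}

/-- For a probability measure with density proportional to `h`, the constant `k` is `(∫ h)⁻¹`. -/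
theorem real_of_eq_smul_withDensity {ν : Measure X} [IsProbabilityMeasure ν] {k : ENNReal}
    {h : X → ℝ} (hν : ν = k • μ.withDensity fun x => ENNReal.ofReal (h x)) (hh : Integrable h μ)
    (h0 : ∀ x, 0 ≤ h x) :
    0 < ∫ x, h x ∂μ ∧ ∀ s, MeasurableSet s → ν.real s = (∫ x in s, h x ∂μ) / ∫ x, h x ∂μ := by
  have key : ∀ s, MeasurableSet s → ν.real s = k.toReal * ∫ x in s, h x ∂μ := fun s hs => by
    rw [measureReal_def, hν, Measure.smul_apply, withDensity_apply _ hs, smul_eq_mul,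
      ← ofReal_integral_eq_lintegral_ofReal hh.integrableOn (.of_forall h0), ENNReal.toReal_mul,
      ENNReal.toReal_ofReal (integral_nonneg h0)]
  have h1 := key _ MeasurableSet.univ
  rw [setIntegral_univ, probReal_univ] at h1
  have hpos : 0 < ∫ x, h x ∂μ := by
    refine (integral_nonneg h0).lt_of_ne fun h => ?_
    rw [← h, mul_zero] at h1
    exact one_ne_zero h1
  refine ⟨hpos, fun s hs => ?_⟩
  rw [key s hs, eq_div_iff hpos.ne', mul_right_comm, ← h1, one_mul]

/-- The total variation distance of two probability measures is controlled by the `L¹` distance of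
their unnormalized densities. -/
theorem tvDist_le_of_eq_smul_withDensity {ν ν' : Measure X} [IsProbabilityMeasure ν]
    [IsProbabilityMeasure ν'] {k k' : ENNReal} {h q : X → ℝ}
    (hν : ν = k • μ.withDensity fun x => ENNReal.ofReal (h x))
    (hν' : ν' = k' • μ.withDensity fun x => ENNReal.ofReal (q x))
    (hh : Integrable h μ) (hq : Integrable q μ) (h0 : ∀ x, 0 ≤ h x) (q0 : ∀ x, 0 ≤ q x) :
    tvDist ν ν' ≤ 2 * (∫ x, |h x - q x| ∂μ) / ∫ x, q x ∂μ := by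
  obtain ⟨hpos, hr⟩ := real_of_eq_smul_withDensity hν hh h0
  obtain ⟨qpos, qr⟩ := real_of_eq_smul_withDensity hν' hq q0
  have : Nonempty {A : Set X // MeasurableSet A} := ⟨⟨∅, MeasurableSet.empty⟩⟩
  refine ciSup_le fun ⟨A, hA⟩ => ?_
  rw [hr A hA, qr A hA]
  set I := ∫ x, h x ∂μ
  set J := ∫ x, q x ∂μ
  set D := ∫ x, |h x - q x| ∂μ
  have hd : ∀ s, |(∫ x in s, h x ∂μ) - ∫ x in s, q x ∂μ| ≤ D := fun s => by
    rw [← integral_sub hh.integrableOn hq.integrableOn]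
    refine (abs_integral_le_integral_abs).trans ?_
    exact setIntegral_le_integral (hh.sub hq).abs (.of_forall fun x => abs_nonneg _)
  have hD := hd Set.univ
  rw [setIntegral_univ, setIntegral_univ] at hD
  have hA0 : 0 ≤ ∫ x in A, h x ∂μ := integral_nonneg h0
  have hA1 : ∫ x in A, h x ∂μ ≤ I := setIntegral_le_integral hh (.of_forall h0)
  have e : (∫ x in A, h x ∂μ) / I - (∫ x in A, q x ∂μ) / J
      = (((∫ x in A, h x ∂μ) / I) * (J - I) + ((∫ x in A, h x ∂μ) - ∫ x in A, q x ∂μ)) / J := by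
    field_simp
    ring
  have h1 : |(∫ x in A, h x ∂μ) / I| ≤ 1 := by
    rw [abs_of_nonneg (by positivity), div_le_one hpos]
    exact hA1
  change |(∫ x in A, h x ∂μ) / I - (∫ x in A, q x ∂μ) / J| ≤ _
  rw [e, abs_div, abs_of_pos qpos]
  refine div_le_div_of_nonneg_right ?_ qpos.le
  refine (abs_add_le _ _).trans ?_
  rw [abs_mul]
  have h2 : |(∫ x in A, h x ∂μ) / I| * |J - I| ≤ 1 * D := by
    rw [abs_sub_comm J I]
    exact mul_le_mul h1 hD (abs_nonneg _) zero_le_one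
  linarith [hd A]

end Densities

/-! ### The Gaussian density -/

section Gaussian

open ProbabilityTheory

variable {d : ℕ}

/-- The two sides have proportional characteristic functions, and the constant is determined by the
value at `0`. -/
theorem exists_stdGaussian_eq_smul_withDensity :
    ∃ k : ENNReal, stdGaussian (EuclideanSpace ℝ (Fin d)) = k • volume.withDensity
      fun x : EuclideanSpace ℝ (Fin d) => ENNReal.ofReal (Real.exp (-2⁻¹ * ‖x‖ ^ 2)) := by
  set p : EuclideanSpace ℝ (Fin d) → ℝ := fun x => Real.exp (-2⁻¹ * ‖x‖ ^ 2) with hp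
  set ν : Measure (EuclideanSpace ℝ (Fin d)) := volume.withDensity fun x => ENNReal.ofReal (p x)
    with hν
  have hpint : Integrable p := integrable_exp_neg_mul_norm_sq (by norm_num)
  have hmeas : Measurable fun x => ENNReal.ofReal (p x) := by fun_prop
  have hfin : IsFiniteMeasure ν := isFiniteMeasure_withDensity_ofReal hpint.2
  have hne : ν Set.univ ≠ 0 := by
    rw [hν, withDensity_apply _ MeasurableSet.univ, Measure.restrict_univ,
      ← ofReal_integral_eq_lintegral_ofReal hpint (.of_forall fun x => (Real.exp_pos _).le)]
    exact (ENNReal.ofReal_pos.2 (integral_exp_pos hpint)).ne'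
  have : NeZero ν := ⟨fun h => hne (by simp [h])⟩
  set k : ENNReal := (ν Set.univ)⁻¹ with hk
  have hprob : IsProbabilityMeasure (k • ν) := isProbabilityMeasureSMul
  have hchar : ∀ t, charFun (k • ν) t = (k.toReal * ((Real.pi / (2⁻¹ : ℂ)) ^ (d / 2 : ℂ)))
      * Complex.exp (-‖t‖ ^ 2 / 2) := by
    intro t
    have hG := GaussianFourier.integral_cexp_neg_mul_sq_norm_add
      (V := EuclideanSpace ℝ (Fin d)) (b := 2⁻¹) (by norm_num) Complex.I t
    rw [charFun_apply, integral_smul_measure, hν,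
      integral_withDensity_eq_integral_toReal_smul hmeas (.of_forall fun x => by simp)]
    have e : ∀ x : EuclideanSpace ℝ (Fin d), (ENNReal.ofReal (p x)).toReal •
        Complex.exp ((inner ℝ x t : ℝ) * Complex.I)
        = Complex.exp (-2⁻¹ * ‖x‖ ^ 2 + Complex.I * (inner ℝ t x : ℝ)) := fun x => by
      rw [ENNReal.toReal_ofReal (Real.exp_pos _).le, Complex.real_smul, Complex.ofReal_exp,
        ← Complex.exp_add, real_inner_comm t x]
      congr 1
      push_cast
      ring
    simp_rw [e]
    rw [hG, finrank_euclideanSpace_fin, Complex.real_smul, Complex.I_sq, ← mul_assoc]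
    congr 2
    ring
  have h1 : (k.toReal * ((Real.pi / (2⁻¹ : ℂ)) ^ (d / 2 : ℂ))) = 1 := by
    have := hchar 0
    simpa using this.symm
  refine ⟨k, Measure.ext_of_charFun ?_⟩
  ext t
  rw [hchar, h1, one_mul, charFun_stdGaussian]

/-- The centred Gaussian with covariance `H⁻¹` has density proportional to `exp (-⟪H u, u⟫ / 2)`. It
is the image of the standard Gaussian under `√(H⁻¹)`, whose inverse is `√(H⁻¹) H`. The factor `κ` is
arbitrary, as `k` absorbs it. -/
theorem exists_multivariateGaussian_eq_smul_withDensity {H : Matrix (Fin d) (Fin d) ℝ}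
    (hH : H.PosDef)
    {B : EuclideanSpace ℝ (Fin d) →L[ℝ] EuclideanSpace ℝ (Fin d) →L[ℝ] ℝ}
    (hB : ∀ u, B u u = -inner ℝ (Matrix.toEuclideanCLM (𝕜 := ℝ) H u) u) {κ : ℝ} (hκ : 0 < κ) :
    ∃ k : ENNReal, multivariateGaussian 0 H⁻¹ =
      k • volume.withDensity fun u => ENNReal.ofReal (quadDensity κ B u) := by
  open scoped MatrixOrder in
  obtain ⟨k₀, hk₀⟩ := exists_stdGaussian_eq_smul_withDensity (d := d)
  set R : Matrix (Fin d) (Fin d) ℝ := CFC.sqrt H⁻¹ with hR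
  have hRR : R * R = H⁻¹ := CFC.sqrt_mul_sqrt_self _ hH.inv.posSemidef.nonneg
  have hHu : IsUnit H.det := (Matrix.isUnit_iff_isUnit_det _).1 hH.isUnit
  have h1 : R * (R * H) = 1 := by rw [← mul_assoc, hRR, Matrix.nonsing_inv_mul _ hHu]
  have h2 : (R * H) * R = 1 := mul_eq_one_comm.1 h1
  set T := Matrix.toEuclideanCLM (n := Fin d) (𝕜 := ℝ) with hT
  have h1' : ∀ x, T R (T (R * H) x) = x := fun x => by
    rw [← mul_apply_eq_comp, ← map_mul, h1, map_one]; rfl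
  have h2' : ∀ x, T (R * H) (T R x) = x := fun x => by
    rw [← mul_apply_eq_comp, ← map_mul, h2, map_one]; rfl
  let e : EuclideanSpace ℝ (Fin d) ≃L[ℝ] EuclideanSpace ℝ (Fin d) :=
    ContinuousLinearEquiv.equivOfInverse (T R) (T (R * H)) h2' h1'
  let e' : EuclideanSpace ℝ (Fin d) ≃ᵐ EuclideanSpace ℝ (Fin d) :=
    e.toHomeomorph.toMeasurableEquiv
  obtain ⟨c, hc⟩ : ∃ c : ENNReal,
      (volume : Measure (EuclideanSpace ℝ (Fin d))).map e' = c • volume :=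
    ⟨_, Measure.map_linearMap_addHaar_eq_smul_addHaar volume
      (f := (e.toLinearEquiv : EuclideanSpace ℝ (Fin d) →ₗ[ℝ] EuclideanSpace ℝ (Fin d)))
      (LinearEquiv.isUnit_det' e.toLinearEquiv).ne_zero⟩
  have hsa : ∀ x y, inner ℝ (T R x) y = inner ℝ x (T R y) := fun x y => by
    have h3 : IsSelfAdjoint (T R) := (CFC.sqrt_nonneg H⁻¹).isSelfAdjoint.map T
    rw [← ContinuousLinearMap.adjoint_inner_left, h3.adjoint_eq]
  have hnorm : ∀ u, ‖T (R * H) u‖ ^ 2 = inner ℝ (T H u) u := fun u => by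
    rw [← real_inner_self_eq_norm_sq]
    conv_lhs => enter [2]; rw [map_mul, mul_apply_eq_comp]
    rw [hsa, h1']
  have hmap : multivariateGaussian 0 H⁻¹ = (stdGaussian (EuclideanSpace ℝ (Fin d))).map e' := by
    rw [multivariateGaussian]
    congr 1
    ext1 x
    rw [zero_add]
    rfl
  have hdens : (fun u => ENNReal.ofReal (Real.exp (-2⁻¹ * ‖e'.symm u‖ ^ 2)))
      = (ENNReal.ofReal κ⁻¹) • fun u => ENNReal.ofReal (quadDensity κ B u) := by
    ext1 u
    rw [Pi.smul_apply, smul_eq_mul, ← ENNReal.ofReal_mul (by positivity), quadDensity, hB,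
      show e'.symm u = T (R * H) u from rfl, hnorm, inv_mul_cancel_left₀ hκ.ne', neg_mul, mul_neg]
  refine ⟨k₀ * c * ENNReal.ofReal κ⁻¹, ?_⟩
  rw [hmap, hk₀, Measure.map_smul, map_withDensity_measurableEquiv, hc, withDensity_smul_measure]
  change k₀ • c • volume.withDensity
    (fun u => ENNReal.ofReal (Real.exp (-2⁻¹ * ‖e'.symm u‖ ^ 2))) = _
  rw [hdens, withDensity_smul' _ _ ENNReal.ofReal_ne_top, smul_smul, smul_smul, mul_assoc]

end Gaussian

/-! ### The rescaled posterior -/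

section Posterior

variable {d : ℕ} {Θ : Set (EuclideanSpace ℝ (Fin d))}
  {prior lik F : EuclideanSpace ℝ (Fin d) → ℝ}

/-- Rescaling by `λ ↦ √n (λ - c)` turns the posterior into the probability measure with density
proportional to `rescaledDensity`. -/
theorem posterior_and_rescaledLaw (hΘ : MeasurableSet Θ) (hprior : ∀ x ∈ Θ, 0 ≤ prior x) {n : ℕ}
    (hn : n ≠ 0) (hlik : ∀ x ∈ Θ, lik x = Real.exp (n * F x)) (c : EuclideanSpace ℝ (Fin d))
    (hint : Integrable (rescaledDensity Θ prior F c n))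
    (hpos : 0 < ∫ u, rescaledDensity Θ prior F c n u) :
    IsProbabilityMeasure (posterior Θ prior lik) ∧
    IsProbabilityMeasure (rescaledLaw (posterior Θ prior lik) n c) ∧
    ∃ k : ENNReal, rescaledLaw (posterior Θ prior lik) n c =
      k • volume.withDensity fun u => ENNReal.ofReal (rescaledDensity Θ prior F c n u) := by
  set J : EuclideanSpace ℝ (Fin d) → ℝ :=
    Θ.indicator fun x => Real.exp (n * (F x - F c)) * prior x with hJ
  have hJ0 : ∀ x, 0 ≤ J x := fun x =>
    Set.indicator_apply_nonneg fun h => mul_nonneg (Real.exp_pos _).le (hprior _ h)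
  have hs : Real.sqrt n ≠ 0 := by positivity
  have hJr : ∀ x, J x = rescaledDensity Θ prior F c n (Real.sqrt n • (x - c)) := fun x => by
    rw [rescaledDensity, smul_smul, inv_mul_cancel₀ hs, one_smul, add_sub_cancel]
  have hJint : Integrable J := by
    have h1 : J = fun x =>
        rescaledDensity Θ prior F c n (-(Real.sqrt n • c) + Real.sqrt n • x) := by
      ext1 x
      rw [hJr, smul_sub, sub_eq_neg_add]
    rw [h1]
    exact integrable_comp_add_smul hint _ hs
  have hJpos : 0 < ∫ x, J x := by
    have h1 : ∫ u, rescaledDensity Θ prior F c n u = Real.sqrt n ^ d * ∫ x, J x :=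
      integral_comp_add_inv_smul J c (Real.sqrt_nonneg _)
    rw [h1] at hpos
    exact pos_of_mul_pos_right hpos (by positivity)
  -- the density of the posterior is a constant multiple of `J`
  set A : ENNReal := ENNReal.ofReal (Real.exp (n * F c)) with hA
  have hdens : (Θ.indicator fun x => ENNReal.ofReal (lik x * prior x))
      = A • fun x => ENNReal.ofReal (J x) := by
    ext1 x
    rw [Pi.smul_apply, smul_eq_mul]
    by_cases hx : x ∈ Θ
    · rw [Set.indicator_of_mem hx, hJ, Set.indicator_of_mem hx, hA,
        ← ENNReal.ofReal_mul (Real.exp_pos _).le, ← mul_assoc, ← Real.exp_add, hlik x hx]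
      congr 3
      ring
    · simp [hJ, Set.indicator_of_notMem hx]
  have hlint : ∫⁻ x in Θ, ENNReal.ofReal (lik x * prior x)
      = A * ENNReal.ofReal (∫ x, J x) := by
    rw [← lintegral_indicator hΘ, hdens,
      ofReal_integral_eq_lintegral_ofReal hJint (.of_forall hJ0)]
    exact lintegral_const_mul' _ _ ENNReal.ofReal_ne_top
  have hprob : IsProbabilityMeasure (posterior Θ prior lik) := by
    refine ⟨?_⟩
    rw [posterior, Measure.smul_apply, withDensity_apply _ MeasurableSet.univ,
      Measure.restrict_univ, smul_eq_mul, hlint]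
    refine ENNReal.inv_mul_cancel ?_ ?_
    · exact mul_ne_zero (ENNReal.ofReal_pos.2 (Real.exp_pos _)).ne'
        (ENNReal.ofReal_pos.2 hJpos).ne'
    · exact ENNReal.mul_ne_top ENNReal.ofReal_ne_top ENNReal.ofReal_ne_top
  let e : EuclideanSpace ℝ (Fin d) ≃ᵐ EuclideanSpace ℝ (Fin d) :=
    ((Homeomorph.addRight (-c)).trans (Homeomorph.smulOfNeZero _ hs)).toMeasurableEquiv
  have he : (fun x => Real.sqrt n • (x - c)) = e := by
    ext1 x
    rw [sub_eq_add_neg]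
    rfl
  obtain ⟨k, hk⟩ : ∃ k : ENNReal,
      (volume : Measure (EuclideanSpace ℝ (Fin d))).map e = k • volume := by
    rw [← he, show (fun x => Real.sqrt n • (x - c)) =
      (fun x => Real.sqrt n • x) ∘ fun x => x - c from rfl,
      ← Measure.map_map (by fun_prop) (by fun_prop),
      (measurePreserving_sub_right volume c).map_eq, Measure.map_addHaar_smul _ hs]
    exact ⟨_, rfl⟩
  refine ⟨hprob, Measure.isProbabilityMeasure_map (by fun_prop),
    (A * ENNReal.ofReal (∫ x, J x))⁻¹ * A * k, ?_⟩
  rw [rescaledLaw, posterior, hlint, ← withDensity_indicator hΘ, hdens,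
    withDensity_smul' _ _ ENNReal.ofReal_ne_top, he, Measure.map_smul, Measure.map_smul,
    map_withDensity_measurableEquiv, hk, withDensity_smul_measure, smul_smul, smul_smul]
  congr 2
  ext1 u
  rw [Function.comp_apply, hJr]
  congr 2
  have := congrFun he (e.symm u)
  rwa [e.apply_symm_apply] at this

end Posterior

/-! ### Hessian matrices -/

section Hessian

variable {d : ℕ} {g : EuclideanSpace ℝ (Fin d) → ℝ} {a : EuclideanSpace ℝ (Fin d)}

theorem inner_toEuclideanCLM_hessian (u : EuclideanSpace ℝ (Fin d)) :
    inner ℝ (Matrix.toEuclideanCLM (𝕜 := ℝ) (hessian g a) u) u =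
      fderiv ℝ (fderiv ℝ g) a u u := by
  have hu : u = ∑ i, u i • EuclideanSpace.single i (1 : ℝ) := by
    simpa using ((EuclideanSpace.basisFun (Fin d) ℝ).sum_repr u).symm
  rw [real_inner_comm, Matrix.inner_toEuclideanCLM]
  conv_rhs => rw [hu]
  simp only [map_sum, map_smul, sum_apply, smul_apply, smul_eq_mul, dotProduct, Matrix.mulVec,
    hessian, Matrix.of_apply, iteratedFDeriv_two_apply, Finset.mul_sum]
  refine Finset.sum_comm.trans (Finset.sum_congr rfl fun i _ => Finset.sum_congr rfl fun j _ => ?_)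
  simp
  ring

theorem posDef_neg_hessian (hg : ContDiffAt ℝ 2 g a)
    (hneg : ∀ v, v ≠ 0 → fderiv ℝ (fderiv ℝ g) a v v < 0) : (-hessian g a).PosDef := by
  refine Matrix.PosDef.of_dotProduct_mulVec_pos ?_ fun x hx => ?_
  · ext i j
    have := hg.isSymmSndFDerivAt (by simp)
      (EuclideanSpace.single i (1 : ℝ)) (EuclideanSpace.single j (1 : ℝ))
    simp [hessian, iteratedFDeriv_two_apply, this]
  · have h1 := hneg (WithLp.toLp 2 x) (by simpa using hx)
    rw [← inner_toEuclideanCLM_hessian, real_inner_comm, Matrix.inner_toEuclideanCLM] at h1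
    simpa [Matrix.neg_mulVec] using h1

end Hessian

/-! ### Asymptotic normality for a convergent sequence of log-likelihoods -/

section Deterministic

open ProbabilityTheory

variable {d : ℕ}

/-- Asymptotic normality of the posteriors with likelihood `exp (n F n)`, when the `F n` converge
to `g` to second order at a nondegenerate maximizer `a` of `g` and stay away from `g a` outside
each neighborhood of `a`. -/
theorem exists_tendsto_tvDist {Θ : Set (EuclideanSpace ℝ (Fin d))}
    {prior : EuclideanSpace ℝ (Fin d) → ℝ} {F lik : ℕ → EuclideanSpace ℝ (Fin d) → ℝ}
    {g : EuclideanSpace ℝ (Fin d) → ℝ} {a : EuclideanSpace ℝ (Fin d)}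
    (hΘm : MeasurableSet Θ) (hΘ : Θ ∈ 𝓝 a)
    (hprior : ContinuousAt prior a) (hprior_pos : 0 < prior a)
    (hprior_nonneg : ∀ x ∈ Θ, 0 ≤ prior x) (hprior_int : IntegrableOn prior Θ)
    (hF : ∀ᶠ n in atTop, AEMeasurable (F n) (volume.restrict Θ))
    (hlik : ∀ᶠ n in atTop, ∀ x ∈ Θ, lik n x = Real.exp (n * F n x))
    (h : TendstoC2At F g a) (hg : fderiv ℝ g a = 0)
    (hneg : ∀ v, v ≠ 0 → fderiv ℝ (fderiv ℝ g) a v v < 0)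
    (hout : ∀ r > 0, ∃ η > 0, ∀ᶠ n in atTop, ∀ x ∈ Θ \ Metric.ball a r, F n x < g a - η) :
    ∃ m : ℕ → EuclideanSpace ℝ (Fin d), Tendsto m atTop (𝓝 a) ∧
      (∀ᶠ n in atTop, HasFDerivAt (F n) (0 : EuclideanSpace ℝ (Fin d) →L[ℝ] ℝ) (m n)) ∧
      Tendsto (fun n => F n (m n)) atTop (𝓝 (g a)) ∧
      (∀ᶠ n in atTop, IsProbabilityMeasure (posterior Θ prior (lik n)) ∧
        rescaledLaw (posterior Θ prior (lik n)) n (m n) ≪ volume) ∧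
      Tendsto (fun n => tvDist (rescaledLaw (posterior Θ prior (lik n)) n (m n))
        (multivariateGaussian 0 (-hessian g a)⁻¹)) atTop (𝓝 0) := by
  obtain ⟨m, hm, hcrit⟩ := h.exists_critical_points hneg hg
  have hval : Tendsto (fun n => F n (m n)) atTop (𝓝 (g a)) :=
    h.tendsto.comp (tendsto_id.prodMk hm)
  have hout' : ∀ r > 0, ∃ η > 0, ∀ᶠ n in atTop, ∀ x ∈ Θ \ Metric.ball a r,
      F n x ≤ F n (m n) - η := fun r hr => by
    obtain ⟨η, hη, hev⟩ := hout r hr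
    refine ⟨η / 2, half_pos hη, ?_⟩
    filter_upwards [hev, hval.eventually_const_lt (show g a - η / 2 < g a by linarith)]
      with n h1 h2 x hx
    linarith [h1 x hx]
  obtain ⟨hint, hL1⟩ := tendsto_integral_abs_rescaledDensity_sub h hneg hm hcrit hΘm hΘ hprior
    hprior_nonneg hprior_int hF hout'
  set q := quadDensity (prior a) (fderiv ℝ (fderiv ℝ g) a) with hq
  have hqint : Integrable q := integrable_quadDensity hneg _
  have hq0 : ∀ u, 0 ≤ q u := fun u => mul_nonneg hprior_pos.le (Real.exp_pos _).le
  obtain ⟨k, hk⟩ := exists_multivariateGaussian_eq_smul_withDensity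
    (posDef_neg_hessian h.contDiffAt_limit hneg) (B := fderiv ℝ (fderiv ℝ g) a)
    (fun u => by simp [← inner_toEuclideanCLM_hessian]) hprior_pos
  have hqpos : 0 < ∫ u, q u := (real_of_eq_smul_withDensity hk hqint hq0).1
  have hpost : ∀ᶠ n in atTop, IsProbabilityMeasure (posterior Θ prior (lik n)) ∧
      IsProbabilityMeasure (rescaledLaw (posterior Θ prior (lik n)) n (m n)) ∧
      ∃ k : ENNReal, rescaledLaw (posterior Θ prior (lik n)) n (m n) =
        k • volume.withDensity
          fun u => ENNReal.ofReal (rescaledDensity Θ prior (F n) (m n) n u) := by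
    filter_upwards [hint, hL1.eventually_lt_const hqpos, hlik, eventually_ne_atTop 0]
      with n h1 h2 h3 h4
    refine posterior_and_rescaledLaw hΘm hprior_nonneg h4 h3 (m n) h1 ?_
    have h5 := (abs_integral_le_integral_abs (μ := volume)
      (f := fun u => rescaledDensity Θ prior (F n) (m n) n u - q u)).trans_lt h2
    rw [integral_sub h1 hqint] at h5
    linarith [(abs_lt.1 h5).1]
  refine ⟨m, hm, hcrit, hval, hpost.mono fun n hn => ⟨hn.1, ?_⟩, ?_⟩
  · obtain ⟨k', hk'⟩ := hn.2.2
    rw [hk']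
    exact (withDensity_absolutelyContinuous _ _).smul_left k'
  · have hlim : Tendsto (fun n => 2 * (∫ u, |rescaledDensity Θ prior (F n) (m n) n u - q u|)
        / ∫ u, q u) atTop (𝓝 0) := by
      simpa using (hL1.const_mul 2).div_const (∫ u, q u)
    refine squeeze_zero' (.of_forall fun n => Real.iSup_nonneg fun A => abs_nonneg _) ?_ hlim
    filter_upwards [hpost, hint] with n hn h1
    obtain ⟨-, hn1, k', hk'⟩ := hn
    exact tvDist_le_of_eq_smul_withDensity hk' hk h1 hqint
      (rescaledDensity_nonneg hprior_nonneg _ _ _) hq0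

end Deterministic

/-! ### Convergence of the profiled log-likelihoods -/

section Profile

variable {X Y : Type*} [NormedAddCommGroup X] [NormedSpace ℝ X]
  [NormedAddCommGroup Y] [NormedSpace ℝ Y]

theorem tendstoC2At_of_bounded_third_deriv [FiniteDimensional ℝ X] [FiniteDimensional ℝ Y]
    {E : Set X} (hE : IsOpen E) {l : ℕ → X × Y → ℝ}
    {l₀ : X × Y → ℝ} {z : ℕ → X → Y} {z₀ : X → Y} {δ M M' : ℝ} (hδ : 0 < δ)
    (hl : ∀ n, 1 ≤ n → ContDiffOn ℝ 3 (l n) (E ×ˢ Metric.thickening δ (z n '' E)) ∧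
      ∀ x ∈ E ×ˢ Metric.thickening δ (z n '' E), ‖iteratedFDeriv ℝ 3 (l n) x‖ ≤ M)
    (hz : ∀ n, 1 ≤ n → ContDiffOn ℝ 3 (z n) E ∧ ∀ x ∈ E, ‖iteratedFDeriv ℝ 3 (z n) x‖ ≤ M')
    (hzlim : ∀ x ∈ E, Tendsto (fun n => z n x) atTop (𝓝 (z₀ x)))
    (hllim : ∀ x ∈ E, ∀ ζ, Tendsto (fun n => l n (x, ζ)) atTop (𝓝 (l₀ (x, ζ))))
    {a : X} (ha : a ∈ E) :
    TendstoC2At l l₀ (a, z₀ a) ∧ TendstoC2At z z₀ a := by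
  obtain ⟨r, hr, hrE⟩ := Metric.isOpen_iff.1 hE a ha
  constructor
  · have hso : IsOpen (Metric.ball a r ×ˢ Metric.ball (z₀ a) (δ / 2)) :=
      Metric.isOpen_ball.prod Metric.isOpen_ball
    refine TendstoC2At.of_bounded_third_deriv (M := M) hso
      ((convex_ball a r).prod (convex_ball _ _)) ?_ (fun x hx => hllim x.1 (hrE hx.1) x.2)
      ⟨Metric.mem_ball_self hr, Metric.mem_ball_self (half_pos hδ)⟩
    -- The centre `z₀ a` is `δ / 2`-close to `z n a`, so the `δ / 2`-ball lies in the thickening.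
    filter_upwards [(hzlim a ha).eventually_mem (Metric.ball_mem_nhds _ (half_pos hδ)),
      eventually_ge_atTop 1] with n h1 h2
    have hsub : Metric.ball a r ×ˢ Metric.ball (z₀ a) (δ / 2) ⊆
        E ×ˢ Metric.thickening δ (z n '' E) := by
      refine Set.prod_mono hrE fun ζ hζ => ?_
      rw [Metric.mem_thickening_iff]
      refine ⟨z n a, ⟨a, ha, rfl⟩, ?_⟩
      have h3 := dist_triangle_right ζ (z n a) (z₀ a)
      have h4 := Metric.mem_ball.1 h1
      have h5 := Metric.mem_ball.1 hζ
      linarith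
    exact ⟨(hl n h2).1.mono hsub, fun x hx => (hl n h2).2 x (hsub hx)⟩
  · refine TendstoC2At.of_bounded_third_deriv (M := M') Metric.isOpen_ball (convex_ball a r) ?_
      (fun x hx => hzlim x (hrE hx)) (Metric.mem_ball_self hr)
    filter_upwards [eventually_ge_atTop 1] with n hn
    exact ⟨(hz n hn).1.mono hrE, fun x hx => (hz n hn).2 x (hrE hx)⟩

/-- The limit of the profiled functions has a nondegenerate critical point at `a`, when `l₀` has a
negative definite Hessian and is stationary in its second argument there. -/
theorem profile_critical_nondegenerate {l₀ : X × Y → ℝ} {z₀ : X → Y} {a : X}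
    (hl : ContDiffAt ℝ 2 l₀ (a, z₀ a)) (hz : ContDiffAt ℝ 2 z₀ a)
    (hhess : ∀ v : X × Y, v ≠ 0 → 0 < -iteratedFDeriv ℝ 2 l₀ (a, z₀ a) ![v, v])
    (hcrit : HasFDerivAt (fun ζ => l₀ (a, ζ)) (0 : Y →L[ℝ] ℝ) (z₀ a)) (v : X) (hv : v ≠ 0) :
    fderiv ℝ (fderiv ℝ (profile l₀ z₀)) a v v < 0 := by
  rw [fderiv_fderiv_profile hl hz hcrit]
  have := hhess (v, fderiv ℝ z₀ a v) (fun h => hv (Prod.ext_iff.1 h).1)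
  rw [iteratedFDeriv_two_apply] at this
  simpa using this

/-- The upper bound on `K` away from `a` comes from compactness, the one outside of `K` from the
assumption on the limit superior. -/
theorem exists_forall_lt_sub_of_limsup_lt {X Y : Type*} [PseudoMetricSpace X] {l : ℕ → X × Y → ℝ}
    {z : ℕ → X → Y} {g : X → ℝ} {Θ K : Set X} {a : X} (hK : IsCompact K)
    (hlim : ∀ x ∈ K, Tendsto (fun q : ℕ × X => profile (l q.1) (z q.1) q.2) (atTop ×ˢ 𝓝 x)
      (𝓝 (g x)))
    (hin : ∀ x ∈ K \ {a}, g x < g a)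
    (hout : limsup (fun n : ℕ => ⨆ x ∈ Θ \ K, ⨆ ζ ∈ z n '' Θ, ((l n (x, ζ) : ℝ) : EReal)) atTop
      < ((g a : ℝ) : EReal)) {r : ℝ} (hr : 0 < r) :
    ∃ η > 0, ∀ᶠ n in atTop, ∀ x ∈ Θ \ Metric.ball a r, profile (l n) (z n) x < g a - η := by
  obtain ⟨η₁, hη₁, h₁⟩ := eventually_forall_mem_compact_lt
    (f := fun n => profile (l n) (z n)) (v := g a) (hK.diff Metric.isOpen_ball)
    (fun x hx => hlim x hx.1)
    (fun x hx => hin x ⟨hx.1, fun h => hx.2 (by rw [h]; exact Metric.mem_ball_self hr)⟩)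
  obtain ⟨b, hb, hba⟩ := EReal.lt_iff_exists_real_btwn.1 hout
  have hba' : b < g a := EReal.coe_lt_coe_iff.1 hba
  refine ⟨min η₁ (g a - b), lt_min hη₁ (by linarith), ?_⟩
  filter_upwards [h₁, eventually_lt_of_limsup_lt hb] with n h2 h3 x hx
  by_cases hxK : x ∈ K
  · linarith [h2 x ⟨hxK, hx.2⟩, min_le_left η₁ (g a - b)]
  · have h4 : ((profile (l n) (z n) x : ℝ) : EReal) ≤
        ⨆ x ∈ Θ \ K, ⨆ ζ ∈ z n '' Θ, ((l n (x, ζ) : ℝ) : EReal) :=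
      le_iSup₂_of_le x ⟨hx.1, hxK⟩ (le_iSup₂_of_le (z n x) ⟨x, hx.1, rfl⟩ le_rfl)
    have h5 := EReal.coe_lt_coe_iff.1 (h4.trans_lt h3)
    linarith [min_le_right η₁ (g a - b)]

end Profile

end BridgedPosterior

/-! ### Bernstein–von Mises for the bridged posterior -/

theorem mainTheorem1
    -- the data `y₁, y₂, …` on a probability space
    {Ω 𝒴 : Type*} [MeasurableSpace Ω] (P : Measure Ω) [IsProbabilityMeasure P]
    (y : ℕ → Ω → 𝒴) {d p : ℕ}
    -- parameter space, true parameter, open bounded set `E`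
    (Θ : Set (EuclideanSpace ℝ (Fin d))) (hΘ : MeasurableSet Θ)
    (lam₀ : EuclideanSpace ℝ (Fin d))
    (E : Set (EuclideanSpace ℝ (Fin d))) (hEopen : IsOpen E)
    (hEbdd : Bornology.IsBounded E) (hEΘ : E ⊆ Θ) (hlam₀ : lam₀ ∈ E)
    -- prior density on `Θ`
    (prior : EuclideanSpace ℝ (Fin d) → ℝ)
    (hprior_nonneg : ∀ lam ∈ Θ, 0 ≤ prior lam)
    (hprior_int : IntegrableOn prior Θ) (hprior_one : ∫ lam in Θ, prior lam = 1)
    (hprior_cont : ContinuousWithinAt prior Θ lam₀) (hprior_pos : 0 < prior lam₀)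
    -- likelihood `L(y_{1:n}, ζ; λ)`, loss `g_n(ζ, y_{1:n}; λ)` and its minimizer `ẑ_n(λ)`
    (L : (n : ℕ) → (Fin n → 𝒴) → EuclideanSpace ℝ (Fin p) → EuclideanSpace ℝ (Fin d) → ℝ)
    (hL : ∀ n, 1 ≤ n → ∀ ys ζ, ∀ lam ∈ Θ, 0 < L n ys ζ lam)
    (g : (n : ℕ) → EuclideanSpace ℝ (Fin p) → (Fin n → 𝒴) → EuclideanSpace ℝ (Fin d) → ℝ)
    (zhat : (n : ℕ) → (Fin n → 𝒴) → EuclideanSpace ℝ (Fin d) → EuclideanSpace ℝ (Fin p))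
    (hzhat : ∀ n, 1 ≤ n → ∀ ys, ∀ lam ∈ Θ,
      BridgedPosterior.IsUniqueArgmin (fun ζ => g n ζ ys lam) (zhat n ys lam))
    (hLmeas : ∀ n, 1 ≤ n → ∀ ys,
      AEMeasurable (fun lam => L n ys (zhat n ys lam) lam) (volume.restrict Θ))
    -- the limits `l_*` and `ẑ_*`
    (lstar : EuclideanSpace ℝ (Fin d) × EuclideanSpace ℝ (Fin p) → ℝ)
    (zstar : EuclideanSpace ℝ (Fin d) → EuclideanSpace ℝ (Fin p))
    -- (A1), for `l_n`: third derivatives continuous and bounded, uniformly in `n`,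
    -- on `E × ẑ_n(E)`, understood with a margin `δ > 0` around `ẑ_n(E)`
    (hA1_l : ∀ᵐ ω ∂P, ∃ δ > 0, ∃ M : ℝ, ∀ n, 1 ≤ n →
      ContDiffOn ℝ 3 (BridgedPosterior.logLik L n (BridgedPosterior.sample y n ω))
        (E ×ˢ Metric.thickening δ (zhat n (BridgedPosterior.sample y n ω) '' E)) ∧
      ∀ x ∈ E ×ˢ Metric.thickening δ (zhat n (BridgedPosterior.sample y n ω) '' E),
        ‖iteratedFDeriv ℝ 3
          (BridgedPosterior.logLik L n (BridgedPosterior.sample y n ω)) x‖ ≤ M)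
    -- (A1), for `ẑ_n`
    (hA1_z : ∀ᵐ ω ∂P, ∃ M : ℝ, ∀ n, 1 ≤ n →
      ContDiffOn ℝ 3 (zhat n (BridgedPosterior.sample y n ω)) E ∧
      ∀ lam ∈ E, ‖iteratedFDeriv ℝ 3 (zhat n (BridgedPosterior.sample y n ω)) lam‖ ≤ M)
    -- (A2)
    (hA2_z : ∀ᵐ ω ∂P, ∀ lam ∈ Θ,
      Tendsto (fun n => zhat n (BridgedPosterior.sample y n ω) lam) atTop (𝓝 (zstar lam)))
    (hA2_l : ∀ᵐ ω ∂P, ∀ lam ∈ Θ, ∀ ζ,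
      Tendsto (fun n => BridgedPosterior.logLik L n (BridgedPosterior.sample y n ω) (lam, ζ))
        atTop (𝓝 (lstar (lam, ζ))))
    -- (A3)
    (hA3_hess : ∀ v : EuclideanSpace ℝ (Fin d) × EuclideanSpace ℝ (Fin p), v ≠ 0 →
      0 < -iteratedFDeriv ℝ 2 lstar (lam₀, zstar lam₀) ![v, v])
    (hA3_crit : HasFDerivAt (fun ζ => lstar (lam₀, ζ))
      (0 : EuclideanSpace ℝ (Fin p) →L[ℝ] ℝ) (zstar lam₀))
    -- (A4)
    (K : Set (EuclideanSpace ℝ (Fin d))) (hK : IsCompact K) (hKE : K ⊆ E)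
    (hlam₀K : lam₀ ∈ interior K)
    (hA4_in : ∀ lam ∈ K \ {lam₀}, ∀ ζ ∈ zstar '' E,
      lstar (lam, ζ) < lstar (lam₀, zstar lam₀))
    (hA4_out : ∀ᵐ ω ∂P,
      limsup (fun n : ℕ =>
        ⨆ lam ∈ Θ \ K, ⨆ ζ ∈ zhat n (BridgedPosterior.sample y n ω) '' Θ,
          ((BridgedPosterior.logLik L n (BridgedPosterior.sample y n ω) (lam, ζ) : ℝ) : EReal))
        atTop < ((lstar (lam₀, zstar lam₀) : ℝ) : EReal)) :
    -- `H₀ = -l̂_*''(λ₀)` is well defined and positive definite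
    ContDiffAt ℝ 2 (BridgedPosterior.profile lstar zstar) lam₀ ∧
    (-BridgedPosterior.hessian (BridgedPosterior.profile lstar zstar) lam₀).PosDef ∧
    ∃ lamSeq : ℕ → Ω → EuclideanSpace ℝ (Fin d), ∀ᵐ ω ∂P,
      Tendsto (fun n => lamSeq n ω) atTop (𝓝 lam₀) ∧
      (∀ᶠ n in atTop, HasFDerivAt
        (BridgedPosterior.profile
          (BridgedPosterior.logLik L n (BridgedPosterior.sample y n ω))
          (zhat n (BridgedPosterior.sample y n ω)))
        (0 : EuclideanSpace ℝ (Fin d) →L[ℝ] ℝ) (lamSeq n ω)) ∧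
      Tendsto (fun n => BridgedPosterior.profile
          (BridgedPosterior.logLik L n (BridgedPosterior.sample y n ω))
          (zhat n (BridgedPosterior.sample y n ω)) (lamSeq n ω))
        atTop (𝓝 (BridgedPosterior.profile lstar zstar lam₀)) ∧
      -- for large `n` the posterior is proper and `√n (λ - λ_n)` has a density
      (∀ᶠ n in atTop,
        IsProbabilityMeasure (BridgedPosterior.posterior Θ prior
          (fun lam => L n (BridgedPosterior.sample y n ω)
            (zhat n (BridgedPosterior.sample y n ω) lam) lam)) ∧
        BridgedPosterior.rescaledLaw (BridgedPosterior.posterior Θ prior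
          (fun lam => L n (BridgedPosterior.sample y n ω)
            (zhat n (BridgedPosterior.sample y n ω) lam) lam)) n (lamSeq n ω) ≪ volume) ∧
      Tendsto (fun n => BridgedPosterior.tvDist
          (BridgedPosterior.rescaledLaw (BridgedPosterior.posterior Θ prior
            (fun lam => L n (BridgedPosterior.sample y n ω)
              (zhat n (BridgedPosterior.sample y n ω) lam) lam)) n (lamSeq n ω))
          (ProbabilityTheory.multivariateGaussian 0
            (-BridgedPosterior.hessian (BridgedPosterior.profile lstar zstar) lam₀)⁻¹))
        atTop (𝓝 0) := by
  have hC2 : ∀ᵐ ω ∂P, ∀ x ∈ E,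
      BridgedPosterior.TendstoC2At
        (fun n => BridgedPosterior.logLik L n (BridgedPosterior.sample y n ω)) lstar
        (x, zstar x) ∧
      BridgedPosterior.TendstoC2At
        (fun n => zhat n (BridgedPosterior.sample y n ω)) zstar x := by
    filter_upwards [hA1_l, hA1_z, hA2_z, hA2_l] with ω ⟨δ, hδ, M, hl⟩ ⟨M', hz⟩ hzlim hllim x hx
    exact BridgedPosterior.tendstoC2At_of_bounded_third_deriv hEopen hδ hl hz
      (fun w hw => hzlim w (hEΘ hw)) (fun w hw => hllim w (hEΘ hw)) hx
  -- The limits are deterministic, so a single outcome yields their regularity.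
  obtain ⟨ω₀, hω₀⟩ := hC2.exists
  obtain ⟨hl₀, hz₀⟩ := hω₀ lam₀ hlam₀
  have hprof := (hl₀.profile hz₀).contDiffAt_limit
  have hneg := BridgedPosterior.profile_critical_nondegenerate hl₀.contDiffAt_limit
    hz₀.contDiffAt_limit hA3_hess hA3_crit
  have hin : ∀ x ∈ K \ {lam₀}, BridgedPosterior.profile lstar zstar x <
      BridgedPosterior.profile lstar zstar lam₀ := fun x hx =>
    hA4_in x hx (zstar x) ⟨x, hKE hx.1, rfl⟩
  have hcrit : fderiv ℝ (BridgedPosterior.profile lstar zstar) lam₀ = 0 := by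
    refine IsLocalMax.fderiv_eq_zero ?_
    filter_upwards [mem_interior_iff_mem_nhds.1 hlam₀K] with x hx
    rcases eq_or_ne x lam₀ with rfl | hne
    · exact le_rfl
    · exact (hin x ⟨hx, hne⟩).le
  refine ⟨hprof, BridgedPosterior.posDef_neg_hessian hprof hneg, ?_⟩
  have hΘ_nhds : Θ ∈ 𝓝 lam₀ := mem_of_superset (hEopen.mem_nhds hlam₀) hEΘ
  have key := (hC2.and hA4_out).mono fun ω ⟨hω, hout⟩ =>
    BridgedPosterior.exists_tendsto_tvDist hΘ hΘ_nhds (hprior_cont.continuousAt hΘ_nhds)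
      hprior_pos hprior_nonneg hprior_int
      (F := fun n => BridgedPosterior.profile
        (BridgedPosterior.logLik L n (BridgedPosterior.sample y n ω))
        (zhat n (BridgedPosterior.sample y n ω)))
      (lik := fun n lam => L n (BridgedPosterior.sample y n ω)
        (zhat n (BridgedPosterior.sample y n ω) lam) lam)
      (by
        filter_upwards [eventually_ge_atTop 1] with n hn
        exact (Real.measurable_log.comp_aemeasurable (hLmeas n hn _)).div_const _)
      (by
        filter_upwards [eventually_ge_atTop 1] with n hn x hx
        have hn0 : (n : ℝ) ≠ 0 := by positivity
        simp only [BridgedPosterior.profile, BridgedPosterior.logLik]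
        rw [mul_div_cancel₀ _ hn0, Real.exp_log (hL n hn _ _ x hx)])
      ((hω lam₀ hlam₀).1.profile (hω lam₀ hlam₀).2) hcrit hneg
      (fun r hr => BridgedPosterior.exists_forall_lt_sub_of_limsup_lt hK
        (fun x hx => ((hω x (hKE hx)).1.profile (hω x (hKE hx)).2).tendsto) hin hout hr)
  obtain ⟨m, hm⟩ := Filter.Eventually.choice key
  exact ⟨fun n ω => m ω n, hm⟩
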